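/- For $f\in L^2(\mathbb R)$ let $$\mathcal G f(x,y)=2^{1/4}\int_{\mathbb R} f(t)e^{-\pi(t-x)^2}e^{-2\pi i y t}\,dt,\qquad \mathcal S f=|\mathcal G f|^2\quad\text{on }\mathbb R^2 .$$ For $v\in\mathbb C^2$ write $v^2=v_1^2+v_2^2$; $|\cdot|$ is the Euclidean norm. Let $\mathfrak a=1/\sqrt2$ and let $\Gamma\subseteq\mathfrak a\mathbb Z^2$ be a finite set. For $A\in\mathbb C^{\Gamma\times\Gamma}$ let $$F_A(z)=\sum_{\lambda,\mu\in\Gamma}A_{\lambda,\mu}\,e^{-\frac\pi4|\lambda-\mu|^2+\pi i(\lambda_1\lambda_2-\mu_1\mu_2)}\,e^{i\pi z^T\mathcal J(\lambda-\mu)}\,e^{-\pi\left(z-\frac{\lambda+\mu}2\right)^2},\quad z\in\mathbb C^2,\qquad \mathcal J=\begin{pmatrix}0&1\\-1&0\end{pmatrix}.$$ For $G:\mathbb C^2\to\mathbb C$ entire and $p,u\in\mathbb R^2$ let $$\mathcal E[G](p,u)=G\Big(p+\tfrac12\begin{pmatrix}1&-i\\ i&1\end{pmatrix}u\Big)\,e^{-\frac\pi2|u|^2-\pi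 i(2p_1+u_1)u_2}.$$ Let $f\in L^2(\mathbb R)$, let $\varepsilon\in(0,e^{-1})$ and let $s>0$ with $s\le\frac{\sqrt{38\pi}}{36}\left(\ln\frac1\varepsilon\right)^{-1/2}$. Let $\Omega\subseteq s\mathbb Z^2$, and let $p,u\in\mathbb R^2$ be such that $$p+\tfrac12u\in\mathcal A(s,\Omega):=\Big\{X\in\mathbb R^2:\ \operatorname{dist}(X,s\mathbb Z^2\setminus\Omega)\ge\tfrac{\sqrt{19}}9\,s^{-1}\Big\}$$ (the distance to the empty set being $\infty$). Let $A\in\mathbb C^{\Gamma\times\Gamma}$ be positive semidefinite with $|F_A(\omega)-\mathcal S f(\omega)|\le\varepsilon$ for all $\omega\in\Omega$, and put $$c_0=\|\mathcal S f\|_{L^\infty(\mathbb R^2)}+64.1\max_{\lambda\in\Gamma}A_{\lambda,\lambda}$$ (the maximum being $0$ if $\Gamma=\emptyset$). Then $$\big|\mathcal E[F_A](p,u)-\mathcal G f(p+u)\,\overline{\mathcal G f(p)}\big|\le 8.6\,(1+5.2\sqrt{c_0})^2\,\sqrt\varepsilon\;e^{\frac{17\pi}{32}|u|^2}.$$ 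-/

import Mathlib

open MeasureTheory
open scoped ENNReal ComplexConjugate ComplexOrder

noncomputable section

namespace GaborPhase

/-- The time-frequency plane `ℝ²` with its Euclidean norm. -/
abbrev Plane : Type := EuclideanSpace ℝ (Fin 2)

/-- The Gabor transform
`𝒢f(x,y) = 2^{1/4} ∫ f(t) e^{-π(t-x)²} e^{-2πiyt} dt`, with `(x,y) = (p 0, p 1)`. -/
def gabor (f : ℝ → ℂ) (p : Plane) : ℂ :=
  (((2 : ℝ) ^ (1 / 4 : ℝ) : ℝ) : ℂ) *
    ∫ t : ℝ, f t * (Real.exp (-Real.pi * (t - p 0) ^ 2) : ℂ) *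
      Complex.exp (-2 * Real.pi * Complex.I * (p 1 : ℂ) * (t : ℂ))

/-- The spectrogram `𝒮f = |𝒢f|²`. -/
def spectrogram (f : ℝ → ℂ) (p : Plane) : ℝ := ‖gabor f p‖ ^ 2

/-- The norm `‖𝒮f‖_{L^∞(ℝ²)}`. -/
def spectrogramSup (f : ℝ → ℂ) : ℝ :=
  (eLpNorm (spectrogram f) ∞ (volume : Measure Plane)).toReal

/-- `𝒯_u[F](p) = F(p+u) · conj (F(p))`. -/
def tensorShift (u : Plane) (F : Plane → ℂ) (p : Plane) : ℂ := F (p + u) * conj (F p)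

/-- The square lattice `h ℤ²`. -/
def squareLattice (h : ℝ) : Set Plane := {x | ∀ i, ∃ k : ℤ, x i = h * k}

/-- The mesh size `𝔞 = 1/√2`. -/
def meshA : ℝ := 1 / √2

/-- `C(λ,μ) = exp(-π/4 |λ-μ|² + πi (λ₁λ₂ - μ₁μ₂))`. -/
def phiConst (l m : Plane) : ℂ :=
  Complex.exp (-(Real.pi / 4 : ℂ) * ((‖l - m‖ ^ 2 : ℝ) : ℂ) +
    Real.pi * Complex.I * ((l 0 * l 1 - m 0 * m 1 : ℝ) : ℂ))

/-- `Φ_{λ,μ}(z) = C(λ,μ) e^{iπ zᵀ J (λ-μ)} e^{-π (z-(λ+μ)/2)²}` for `z ∈ ℂ²`, where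
`J = (0 1; -1 0)`, so that `zᵀ J v = z₁ v₂ - z₂ v₁`, and `w² = w₁² + w₂²`
(no complex conjugation). -/
def phi (l m : Plane) (z : Fin 2 → ℂ) : ℂ :=
  phiConst l m *
    Complex.exp (Complex.I * Real.pi *
      (z 0 * ((l 1 - m 1 : ℝ) : ℂ) - z 1 * ((l 0 - m 0 : ℝ) : ℂ))) *
    Complex.exp (-Real.pi * ∑ i : Fin 2, (z i - (((l i + m i) / 2 : ℝ) : ℂ)) ^ 2)

/-- The Ansatz function `F_A(z) = ∑_{λ,μ ∈ Γ} A_{λ,μ} Φ_{λ,μ}(z)`. -/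
def ansatz {Γ : Finset Plane} (A : Matrix Γ Γ ℂ) (z : Fin 2 → ℂ) : ℂ :=
  ∑ l : Γ, ∑ m : Γ, A l m * phi l m z

/-- The embedding `ℝ² ⊆ ℂ²`. -/
def toC (p : Plane) : Fin 2 → ℂ := fun i => (p i : ℂ)

/-- `L(p,u) = p + ½ (1 -i; i 1) u`. -/
def evalL (p u : Plane) : Fin 2 → ℂ :=
  ![(p 0 : ℂ) + (1 / 2) * ((u 0 : ℂ) - Complex.I * (u 1 : ℂ)),
    (p 1 : ℂ) + (1 / 2) * (Complex.I * (u 0 : ℂ) + (u 1 : ℂ))]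

/-- `Q(p,u) = -π/2 |u|² - πi (2p₁+u₁) u₂`. -/
def evalQ (p u : Plane) : ℂ :=
  -(Real.pi / 2 : ℂ) * ((‖u‖ ^ 2 : ℝ) : ℂ) -
    Real.pi * Complex.I * (((2 * p 0 + u 0) * u 1 : ℝ) : ℂ)

/-- The evaluation operator `ℰ[G](p,u) = G(L(p,u)) e^{Q(p,u)}`. -/
def evalOp (G : (Fin 2 → ℂ) → ℂ) (p u : Plane) : ℂ := G (evalL p u) * Complex.exp (evalQ p u)

/-- The admissible set: positive semidefinite `A ∈ ℂ^{Γ×Γ}` such that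
`|F_A(ω) - 𝒮f(ω)| ≤ ε` for all `ω ∈ Ω`. -/
def admissible (ε : ℝ) (f : ℝ → ℂ) (Γ : Finset Plane) (Ω : Set Plane) : Set (Matrix Γ Γ ℂ) :=
  {A | A.PosSemidef ∧ ∀ ω ∈ Ω, ‖ansatz A (toC ω) - (spectrogram f ω : ℂ)‖ ≤ ε}

/-- `𝒜(s,Ω) = {X : dist(X, sℤ² \ Ω) ≥ (√19/9) s⁻¹}`; the distance is taken in `[0,∞]`, so that
the distance to the empty set is `∞`. -/
def interiorRegion (s : ℝ) (Ω : Set Plane) : Set Plane :=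
  {X | ENNReal.ofReal (√19 / 9 * s⁻¹) ≤ Metric.infEDist X (squareLattice s \ Ω)}

/-- `max_{λ ∈ Γ} A_{λ,λ}` (equal to `0` for empty `Γ`); the diagonal entries of a positive
semidefinite matrix are real. -/
def maxDiag {Γ : Finset Plane} (A : Matrix Γ Γ ℂ) : ℝ := ⨆ l : Γ, (A l l).re

/-- `c₀ = ‖𝒮f‖_{L^∞(ℝ²)} + 64.1 max_{λ ∈ Γ} A_{λ,λ}`. -/
def c0 (f : ℝ → ℂ) {Γ : Finset Plane} (A : Matrix Γ Γ ℂ) : ℝ :=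
  spectrogramSup f + 64.1 * maxDiag A

end GaborPhase

end

noncomputable section

/-! The spectrogram extends to an entire function on `ℂ²`, and `evalOp` applied to this extension
gives `𝒢f(p+u) · conj (𝒢f(p))` exactly (`evalOp_spectrogramExt`). So it suffices to bound the entire
function D = `ansatz A` - `spectrogramExt f` at one complex point X + ib, with X = p + u/2 and |b| =
|u|/2. Two facts are available: |D(x+iy)| ≤ c₀ exp(2π|y|²) everywhere (`norm_ansatz_le`,
`norm_spectrogramExt_le`), and |D| ≤ ε on Ω.

Multiply D by exp(-π/8 (z-X)²). The product decays like exp(-π/8 |x-X|²) in real directions and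
grows at most like exp(17π/8 |y|²) in imaginary ones. Shifting the contour bounds its real Fourier
transform by 8c₀ exp(-8π/17 |ξ|²) (`GaussianExt.norm_fourier_le`). For low frequencies, π|ξ|² ≤
(17/8) log(1/ε), the transform is also computed by the trapezoidal rule on sℤ². Samples in Ω are
O(ε), those outside Ω lie so far from X that the Gaussian makes them O(ε c₀), and the aliases from
Poisson summation are O(ε c₀) as well (`GaussianExt.norm_fourier_le_of_samples`, `sum_samples_le`,
`aliasing_decay`).

The geometric mean of the two bounds gives √ε exp(-4π/17 |ξ|²) at low frequencies. At high
frequencies half of the decay is already below √ε (`norm_fourier_le_sqrt`). What remains of the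
decay lets Fourier inversion run at complex points (`GaussianExt.norm_le_of_fourier_le`), which
yields the claim after the Gaussian factors are removed. -/

namespace GaborPhase

open Filter Topology Metric
open scoped FourierTransform RealInnerProductSpace

/-! ### Holomorphic parameter integrals, contour shifts and Fourier decay. -/

/-- A parametric integral of entire functions that is locally uniformly dominated is entire. -/
theorem differentiable_integral_of_dominated {α : Type*} [MeasurableSpace α] {μ : Measure α}
    {F : ℂ → α → ℂ} (hmeas : ∀ τ, AEStronglyMeasurable (F τ) μ)
    (hdiff : ∀ x, Differentiable ℂ fun τ => F τ x)
    (hdom : ∀ R : ℝ, ∃ g : α → ℝ, Integrable g μ ∧ ∀ x τ, ‖τ‖ ≤ R → ‖F τ x‖ ≤ g x) :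
    Differentiable ℂ fun τ => ∫ x, F τ x ∂μ := by
  intro τ₀
  -- One unit of room for the ball around `τ₀`, one for the Cauchy circle that bounds the derivative
  -- there.
  obtain ⟨g, hg, hFg⟩ := hdom (‖τ₀‖ + 2)
  have hint : ∀ τ, ‖τ‖ ≤ ‖τ₀‖ + 2 → Integrable (F τ) μ := fun τ hτ =>
    hg.mono' (hmeas τ) (Eventually.of_forall fun x => hFg x τ hτ)
  have hbound : ∀ x, ∀ τ ∈ ball τ₀ 1, ‖deriv (fun τ => F τ x) τ‖ ≤ g x := by
    intro x τ hτ
    have := Complex.norm_deriv_le_of_forall_mem_sphere_norm_le (c := τ) (R := 1) (C := g x)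
      one_pos (hdiff x).diffContOnCl (fun z hz => hFg x z ?_)
    · simpa using this
    · have h1 : ‖z - τ‖ = 1 := by simpa [dist_eq_norm] using hz
      have h2 : ‖τ - τ₀‖ < 1 := by simpa [dist_eq_norm] using hτ
      calc ‖z‖ = ‖(z - τ) + (τ - τ₀) + τ₀‖ := by congr 1; ring
        _ ≤ ‖z - τ‖ + ‖τ - τ₀‖ + ‖τ₀‖ := norm_add₃_le
        _ ≤ ‖τ₀‖ + 2 := by linarith
  have hF'meas : AEStronglyMeasurable (fun x => deriv (fun τ => F τ x) τ₀) μ := by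
    -- Measurability of the derivative in `x`: it is a pointwise limit of measurable difference
    -- quotients.
    have hseq : Tendsto (fun n : ℕ => τ₀ + (1 / ((n : ℂ) + 1))) atTop (𝓝[≠] τ₀) := by
      rw [tendsto_nhdsWithin_iff]
      constructor
      · simpa using tendsto_const_nhds.add (tendsto_one_div_add_atTop_nhds_zero_nat (𝕜 := ℂ))
      · refine Eventually.of_forall fun n => ?_
        have : (n : ℂ) + 1 ≠ 0 := by exact_mod_cast Nat.succ_ne_zero n
        simpa using this
    refine aestronglyMeasurable_of_tendsto_ae (atTop : Filter ℕ)
      (f := fun n x => slope (fun τ => F τ x) τ₀ (τ₀ + (1 / ((n : ℂ) + 1)))) (fun n => ?_) ?_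
    · simp only [slope_def_field, div_eq_mul_inv]
      exact AEStronglyMeasurable.mul_const ((hmeas _).sub (hmeas _)) _
    · refine Eventually.of_forall fun x => ?_
      exact (hasDerivAt_iff_tendsto_slope.1 (hdiff x τ₀).hasDerivAt).comp hseq
  exact (hasDerivAt_integral_of_dominated_loc_of_deriv_le (F := F)
    (F' := fun τ x => deriv (fun τ => F τ x) τ) (ball_mem_nhds τ₀ one_pos)
    (Eventually.of_forall hmeas) (hint τ₀ (by linarith)) hF'meas
    (Eventually.of_forall hbound) hg
    (Eventually.of_forall fun x τ _ => (hdiff x τ).hasDerivAt)).2.differentiableAt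

/-- `H x y` represents the values `h (x + i y)` of a function `h` on the complexification of `V`
that is holomorphic along complex lines, with Gaussian decay around `X` and Gaussian growth in the
imaginary directions. -/
structure GaussianExt {V : Type*} [NormedAddCommGroup V] [InnerProductSpace ℝ V]
    (H : V → V → ℂ) (X : V) (C α β : ℝ) : Prop where
  cont : ∀ y, Continuous fun x => H x y
  hol : ∀ x v, ∃ g : ℂ → ℂ, Differentiable ℂ g ∧
    ∀ τ : ℂ, g τ = H (x + τ.re • v) (τ.im • v)
  bound : ∀ x y, ‖H x y‖ ≤ C * Real.exp (-α * ‖x - X‖ ^ 2 + β * ‖y‖ ^ 2)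

theorem GaussianExt.nonneg {V : Type*} [NormedAddCommGroup V] [InnerProductSpace ℝ V]
    {H : V → V → ℂ} {X : V} {C α β : ℝ} (hH : GaussianExt H X C α β) :
    0 ≤ C := by
  have h := (norm_nonneg _).trans (hH.bound 0 0)
  exact nonneg_of_mul_nonneg_left h (Real.exp_pos _)

section FiniteDimensional

variable {V : Type*} [NormedAddCommGroup V] [InnerProductSpace ℝ V] [FiniteDimensional ℝ V]
  [MeasurableSpace V] [BorelSpace V]

/-- Contour shift: if `F τ` is the translate by `τ • v` for real `τ`, and depends holomorphically
on `τ`, then its integral does not depend on `τ`. -/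
theorem integral_eq_of_translate {F : ℂ → V → ℂ} (v : V)
    (hmeas : ∀ τ, AEStronglyMeasurable (F τ) volume)
    (hdiff : ∀ x, Differentiable ℂ fun τ => F τ x)
    (hdom : ∀ R : ℝ, ∃ g : V → ℝ, Integrable g ∧ ∀ x τ, ‖τ‖ ≤ R → ‖F τ x‖ ≤ g x)
    (htrans : ∀ (t : ℝ) x, F t x = F 0 (x + t • v)) (τ : ℂ) :
    ∫ x, F τ x = ∫ x, F 0 x := by
  have hd := differentiable_integral_of_dominated hmeas hdiff hdom
  have hreal : ∀ t : ℝ, ∫ x, F t x = ∫ x, F 0 x := fun t => by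
    simp_rw [htrans t]
    exact integral_add_right_eq_self (F 0) (t • v)
  have hA : AnalyticOnNhd ℂ (fun τ => ∫ x, F τ x) Set.univ :=
    hd.differentiableOn.analyticOnNhd isOpen_univ
  -- The integral is constant at real points accumulating at 0, so the identity theorem makes it
  -- constant.
  have hseq : Tendsto (fun n : ℕ => (1 / ((n : ℂ) + 1))) atTop (𝓝[≠] 0) := by
    rw [tendsto_nhdsWithin_iff]
    refine ⟨tendsto_one_div_add_atTop_nhds_zero_nat (𝕜 := ℂ), Eventually.of_forall fun n => ?_⟩
    have : (n : ℂ) + 1 ≠ 0 := by exact_mod_cast Nat.succ_ne_zero n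
    simpa using this
  have := hA.eq_of_frequently_eq (g := fun _ => ∫ x, F 0 x) (z₀ := 0)
    (fun _ _ => analyticAt_const)
    (hseq.frequently (Eventually.of_forall fun n => by
      have := hreal (1 / ((n : ℝ) + 1))
      simpa using this).frequently)
  exact congrFun this τ

theorem integrable_exp_neg_mul_sq_norm_sub {α : ℝ} (hα : 0 < α) (X : V) :
    Integrable fun x : V => Real.exp (-α * ‖x - X‖ ^ 2) := by
  have h := GaussianFourier.integrable_cexp_neg_mul_sq_norm_add (V := V) (b := (α : ℂ))
    (by simpa using hα) 0 0
  have h2 : Integrable fun x : V => Real.exp (-α * ‖x‖ ^ 2) := by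
    refine h.norm.congr (Eventually.of_forall fun x => ?_)
    simp only [Complex.norm_exp]
    congr 1
    simp [← Complex.ofReal_pow]
  exact h2.comp_sub_right X

theorem integral_exp_neg_mul_sq_norm_sub {α : ℝ} (hα : 0 < α) (X : V) :
    ∫ x : V, Real.exp (-α * ‖x - X‖ ^ 2) = (Real.pi / α) ^ (Module.finrank ℝ V / 2 : ℝ) := by
  rw [integral_sub_right_eq_self (fun x : V => Real.exp (-α * ‖x‖ ^ 2)) X]
  exact GaussianFourier.integral_rexp_neg_mul_sq_norm hα

theorem GaussianExt.integrable {H : V → V → ℂ} {X : V} {C α β : ℝ} (hH : GaussianExt H X C α β)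
    (hα : 0 < α) (y : V) : Integrable fun x => H x y := by
  refine (((integrable_exp_neg_mul_sq_norm_sub hα X).mul_const
    (Real.exp (β * ‖y‖ ^ 2))).const_mul C).mono' (hH.cont y).aestronglyMeasurable
    (Eventually.of_forall fun x => ?_)
  rw [← Real.exp_add]
  exact hH.bound x y

/-- Fourier transform along a shifted real subspace. -/
theorem GaussianExt.fourier_shift {H : V → V → ℂ} {X : V} {C α β : ℝ}
    (hH : GaussianExt H X C α β) (hα : 0 < α) (hβ : 0 ≤ β) (y ξ : V) :
    𝓕 (fun x => H x y) ξ = Complex.exp (-(2 * Real.pi * ⟪y, ξ⟫ : ℝ)) * 𝓕 (fun x => H x 0) ξ := by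
  choose g hg hgH using fun x => hH.hol x y
  -- The Fourier integrand at the complex point x + τy: real `τ` translates it, and `τ = I` reaches
  -- the shifted subspace.
  let F : ℂ → V → ℂ := fun τ x =>
    g x τ * Complex.exp (-(2 * Real.pi * Complex.I) * (⟪x, ξ⟫ + τ * ⟪y, ξ⟫))
  have hmeas : ∀ τ, AEStronglyMeasurable (F τ) volume := by
    intro τ
    refine Continuous.aestronglyMeasurable ?_
    simp only [F, hgH]
    refine Continuous.mul ((hH.cont (τ.im • y)).comp (by fun_prop)) (by fun_prop)
  have hdiff : ∀ x, Differentiable ℂ fun τ => F τ x := by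
    intro x
    exact (hg x).mul (by fun_prop)
  have hdom : ∀ R : ℝ, ∃ G : V → ℝ, Integrable G ∧ ∀ x τ, ‖τ‖ ≤ R → ‖F τ x‖ ≤ G x := by
    intro R
    -- Half of the rate α is given up to absorb the translation by `τ.re • y`.
    refine ⟨fun x => C * Real.exp (α * R ^ 2 * ‖y‖ ^ 2 + β * R ^ 2 * ‖y‖ ^ 2 +
      2 * Real.pi * (R * |⟪y, ξ⟫|)) * Real.exp (-(α / 2) * ‖x - X‖ ^ 2),
      (integrable_exp_neg_mul_sq_norm_sub (by positivity) X).const_mul _, fun x τ hτ => ?_⟩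
    have hre : |τ.re| ≤ R := (Complex.abs_re_le_norm τ).trans hτ
    have him : |τ.im| ≤ R := (Complex.abs_im_le_norm τ).trans hτ
    have hre2 : τ.re ^ 2 ≤ R ^ 2 := sq_le_sq.2 (hre.trans (le_abs_self R))
    have him2 : τ.im ^ 2 ≤ R ^ 2 := sq_le_sq.2 (him.trans (le_abs_self R))
    have hn : ‖F τ x‖ = ‖H (x + τ.re • y) (τ.im • y)‖ *
        Real.exp (2 * Real.pi * (τ.im * ⟪y, ξ⟫)) := by
      simp only [F, norm_mul, hgH, Complex.norm_exp]
      congr 2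
      simp
    rw [hn]
    refine (mul_le_mul_of_nonneg_right (hH.bound _ _) (Real.exp_pos _).le).trans ?_
    beta_reduce
    rw [mul_assoc C, mul_assoc C, ← Real.exp_add, ← Real.exp_add]
    refine mul_le_mul_of_nonneg_left (Real.exp_le_exp.2 ?_) hH.nonneg
    have h1 : ‖τ.im • y‖ ^ 2 ≤ R ^ 2 * ‖y‖ ^ 2 := by
      rw [norm_smul, mul_pow, Real.norm_eq_abs, sq_abs]
      gcongr
    have h2 : ‖x - X‖ ^ 2 ≤ 2 * ‖x + τ.re • y - X‖ ^ 2 + 2 * (R ^ 2 * ‖y‖ ^ 2) := by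
      have h3 : ‖τ.re • y‖ ^ 2 ≤ R ^ 2 * ‖y‖ ^ 2 := by
        rw [norm_smul, mul_pow, Real.norm_eq_abs, sq_abs]
        gcongr
      have h4 : ‖x - X‖ ≤ ‖x + τ.re • y - X‖ + ‖τ.re • y‖ := by
        have : x - X = (x + τ.re • y - X) - τ.re • y := by abel
        rw [this]; exact norm_sub_le _ _
      have h5 : ‖x - X‖ ^ 2 ≤ (‖x + τ.re • y - X‖ + ‖τ.re • y‖) ^ 2 := by gcongr
      nlinarith [sq_nonneg (‖x + τ.re • y - X‖ - ‖τ.re • y‖)]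
    have h6 : τ.im * ⟪y, ξ⟫ ≤ R * |⟪y, ξ⟫| := by
      calc τ.im * ⟪y, ξ⟫ ≤ |τ.im * ⟪y, ξ⟫| := le_abs_self _
        _ = |τ.im| * |⟪y, ξ⟫| := abs_mul _ _
        _ ≤ R * |⟪y, ξ⟫| := by gcongr
    have h7 := mul_le_mul_of_nonneg_left h2 (by positivity : 0 ≤ α / 2)
    have h8 := mul_le_mul_of_nonneg_left h1 hβ
    have h9 := mul_le_mul_of_nonneg_left h6 Real.two_pi_pos.le
    nlinarith
  have htrans : ∀ (t : ℝ) x, F t x = F 0 (x + t • y) := by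
    intro t x
    simp only [F, hgH, inner_add_left, real_inner_smul_left]
    simp
  have key := integral_eq_of_translate y hmeas hdiff hdom htrans Complex.I
  rw [Real.fourier_eq', Real.fourier_eq']
  have e1 : (fun x => Complex.exp ((-2 * Real.pi * ⟪x, ξ⟫ : ℝ) * Complex.I) • H x y) =
      fun x => Complex.exp (-(2 * Real.pi * ⟪y, ξ⟫ : ℝ)) * F Complex.I x := by
    ext x
    simp only [F, hgH, smul_eq_mul]
    simp only [Complex.I_re, zero_smul, add_zero, Complex.I_im, one_smul]
    rw [mul_comm (H x y), ← mul_assoc, ← Complex.exp_add]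
    congr 2
    push_cast
    linear_combination (2 * Real.pi * (⟪y, ξ⟫ : ℝ)) * Complex.I_sq
  have e2 : (fun x => Complex.exp ((-2 * Real.pi * ⟪x, ξ⟫ : ℝ) * Complex.I) • H x 0) = F 0 := by
    ext x
    simp only [F, hgH, smul_eq_mul]
    simp only [Complex.zero_re, zero_smul, add_zero, Complex.zero_im, zero_mul]
    rw [mul_comm (H x 0)]
    congr 2
    push_cast
    ring
  rw [e1, e2, integral_const_mul, key]

/-- Gaussian decay of the Fourier transform. -/
theorem GaussianExt.norm_fourier_le {H : V → V → ℂ} {X : V} {C α β : ℝ}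
    (hH : GaussianExt H X C α β) (hα : 0 < α) (hβ : 0 < β) (ξ : V) :
    ‖𝓕 (fun x => H x 0) ξ‖ ≤ C * (Real.pi / α) ^ (Module.finrank ℝ V / 2 : ℝ) *
      Real.exp (-(Real.pi ^ 2 / β) * ‖ξ‖ ^ 2) := by
  -- The shift that minimizes β|y|² + 2π⟪y, ξ⟫; the minimum is -(π²/β)|ξ|².
  set y : V := -(Real.pi / β) • ξ with hy
  have hs := hH.fourier_shift hα hβ.le y ξ
  have hyξ : ⟪y, ξ⟫ = -(Real.pi / β) * ‖ξ‖ ^ 2 := by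
    rw [hy, real_inner_smul_left, real_inner_self_eq_norm_sq]
  have hyn : ‖y‖ ^ 2 = (Real.pi / β) ^ 2 * ‖ξ‖ ^ 2 := by
    rw [hy, norm_smul, mul_pow, Real.norm_eq_abs, sq_abs, neg_sq]
  have h1 : ‖𝓕 (fun x => H x y) ξ‖ ≤
      C * Real.exp (β * ‖y‖ ^ 2) * (Real.pi / α) ^ (Module.finrank ℝ V / 2 : ℝ) := by
    rw [Real.fourier_eq']
    refine (norm_integral_le_integral_norm _).trans ?_
    rw [← integral_exp_neg_mul_sq_norm_sub hα X, ← integral_const_mul]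
    refine integral_mono_of_nonneg (Eventually.of_forall fun x => norm_nonneg _)
      ((integrable_exp_neg_mul_sq_norm_sub hα X).const_mul _) (Eventually.of_forall fun x => ?_)
    simp only [norm_smul, Complex.norm_exp_ofReal_mul_I, one_mul]
    rw [mul_assoc, ← Real.exp_add, add_comm]
    exact hH.bound x y
  have h2 : ‖𝓕 (fun x => H x 0) ξ‖ =
      Real.exp (2 * Real.pi * ⟪y, ξ⟫) * ‖𝓕 (fun x => H x y) ξ‖ := by
    rw [hs, norm_mul, Complex.norm_exp, ← mul_assoc, ← Real.exp_add]
    simp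
  rw [h2]
  refine (mul_le_mul_of_nonneg_left h1 (Real.exp_pos _).le).trans (le_of_eq ?_)
  rw [hyξ, hyn]
  have : Real.exp (-(Real.pi ^ 2 / β) * ‖ξ‖ ^ 2) =
      Real.exp (2 * Real.pi * (-(Real.pi / β) * ‖ξ‖ ^ 2)) *
        Real.exp (β * ((Real.pi / β) ^ 2 * ‖ξ‖ ^ 2)) := by
    rw [← Real.exp_add]
    congr 1
    field_simp
    ring
  rw [this]
  ring

end FiniteDimensional

/-! ### Gaussian integrals and Gaussian sums over square lattices. -/

theorem norm_sq_plane (x : Plane) : ‖x‖ ^ 2 = x 0 ^ 2 + x 1 ^ 2 := by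
  simp [EuclideanSpace.norm_sq_eq, Fin.sum_univ_two]

theorem volume_unit_ball_plane : (volume : Measure Plane).real (ball 0 1) = Real.pi := by
  rw [measureReal_def, EuclideanSpace.volume_ball]
  have h2 : Real.Gamma (1 + 1) = 1 := by rw [one_add_one_eq_two, Real.Gamma_two]
  simp [Real.sq_sqrt Real.pi_pos.le, h2, Real.pi_pos.le]

/-- The Gaussian mass outside a disc. -/
theorem integral_gaussian_outside_disc {a ρ : ℝ} (ha : 0 < a) (hρ : 0 ≤ ρ) :
    ∫ x : Plane, (Set.Ioi ρ).indicator (fun y => Real.exp (-a * y ^ 2)) ‖x‖ =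
      Real.pi / a * Real.exp (-a * ρ ^ 2) := by
  -- Polar coordinates: the Jacobian factor y makes the radial integrand an exact derivative.
  rw [integral_fun_norm_addHaar (volume : Measure Plane)
    ((Set.Ioi ρ).indicator fun y => Real.exp (-a * y ^ 2)), volume_unit_ball_plane]
  have hd : ∀ y ∈ Set.Ici ρ, HasDerivAt (fun y : ℝ => -(1 / (2 * a)) * Real.exp (-a * y ^ 2))
      (y * Real.exp (-a * y ^ 2)) y := by
    intro y _
    have h1 : HasDerivAt (fun y : ℝ => -a * y ^ 2) (-a * (2 * y)) y := by
      simpa using (hasDerivAt_pow 2 y).const_mul (-a)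
    refine (h1.exp.const_mul (-(1 / (2 * a)))).congr_deriv ?_
    have : a ≠ 0 := ha.ne'
    field_simp
  have hlim : Tendsto (fun y : ℝ => -(1 / (2 * a)) * Real.exp (-a * y ^ 2)) atTop (𝓝 0) := by
    have : Tendsto (fun y : ℝ => -a * y ^ 2) atTop atBot :=
      (tendsto_pow_atTop two_ne_zero).const_mul_atTop_of_neg (by linarith)
    simpa using (Real.tendsto_exp_atBot.comp this).const_mul (-(1 / (2 * a)))
  have hI := integral_Ioi_of_hasDerivAt_of_nonneg' hd
    (fun y hy => mul_nonneg (hρ.trans (le_of_lt hy)) (Real.exp_pos _).le) hlim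
  have h2 : ∫ y in Set.Ioi (0 : ℝ), y ^ (Module.finrank ℝ Plane - 1) •
      (Set.Ioi ρ).indicator (fun y => Real.exp (-a * y ^ 2)) y =
      ∫ y in Set.Ioi ρ, y * Real.exp (-a * y ^ 2) := by
    rw [← integral_indicator measurableSet_Ioi, ← integral_indicator measurableSet_Ioi]
    congr 1
    ext y
    by_cases hy : ρ < y
    · simp [Set.indicator, hy, hρ.trans_lt hy]
    · simp [Set.indicator, hy]
  rw [h2, hI]
  simp
  field_simp

/-- The open square cell of side `h`. -/
def cell (h : ℝ) : Set Plane := {q | ∀ i, |q i| < h / 2}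

theorem measurableSet_cell (h : ℝ) : MeasurableSet (cell h) := by
  have : cell h = ⋂ i : Fin 2, {q : Plane | |q i| < h / 2} := by ext; simp [cell]
  rw [this]
  exact MeasurableSet.iInter fun i => measurableSet_lt (by fun_prop) measurable_const

theorem volume_cell {h : ℝ} (hh : 0 < h) : volume (cell h) = ENNReal.ofReal (h ^ 2) := by
  rw [← (PiLp.volume_preserving_toLp (Fin 2)).measure_preimage
    (measurableSet_cell h).nullMeasurableSet]
  have : (WithLp.toLp 2 : (Fin 2 → ℝ) → Plane) ⁻¹' cell h =
      Set.pi Set.univ fun _ : Fin 2 => Set.Ioo (-(h / 2)) (h / 2) := by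
    ext q
    simp [cell, abs_lt]
  rw [this, Real.volume_pi_Ioo, Fin.prod_univ_two, ← ENNReal.ofReal_mul (by linarith)]
  congr 1
  ring

theorem norm_sq_le_of_mem_cell {h : ℝ} {q : Plane} (hq : q ∈ cell h) : ‖q‖ ^ 2 ≤ h ^ 2 / 2 := by
  rw [norm_sq_plane]
  have h0 := sq_lt_sq' (abs_lt.1 (hq 0)).1 (abs_lt.1 (hq 0)).2
  have h1 := sq_lt_sq' (abs_lt.1 (hq 1)).1 (abs_lt.1 (hq 1)).2
  nlinarith

/-- The integrand is odd and the cell is symmetric. This removes the linear term when a Gaussian is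
averaged over a cell. -/
theorem integral_inner_cell (h : ℝ) (w : Plane) : ∫ q in cell h, ⟪w, q⟫ = 0 := by
  rw [← integral_indicator (measurableSet_cell h)]
  have h1 := integral_neg_eq_self (fun q => (cell h).indicator (fun q => ⟪w, q⟫) q)
    (volume : Measure Plane)
  have h2 : (fun q : Plane => (cell h).indicator (fun q => ⟪w, q⟫) (-q)) =
      fun q => -(cell h).indicator (fun q => ⟪w, q⟫) q := by
    ext q
    have : -q ∈ cell h ↔ q ∈ cell h := by simp [cell]
    by_cases hq : q ∈ cell h
    · rw [Set.indicator_of_mem (this.2 hq), Set.indicator_of_mem hq, inner_neg_right]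
    · rw [Set.indicator_of_notMem (fun h' => hq (this.1 h')), Set.indicator_of_notMem hq, neg_zero]
  rw [h2, integral_neg] at h1
  linarith

/-- A Gaussian at the centre of a cell is controlled by its mean over the cell. -/
theorem gaussian_le_integral_cell {a h : ℝ} (ha : 0 < a) (hh : 0 < h) (w : Plane) :
    h ^ 2 * Real.exp (-a * ‖w‖ ^ 2) ≤
      Real.exp (a * h ^ 2 / 2) * ∫ q in cell h, Real.exp (-a * ‖w + q‖ ^ 2) := by
  have hfin : IsFiniteMeasure ((volume : Measure Plane).restrict (cell h)) :=
    ⟨by rw [Measure.restrict_apply_univ, volume_cell hh]; exact ENNReal.ofReal_lt_top⟩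
  have hin : IntegrableOn (fun q : Plane => ⟪w, q⟫) (cell h) := by
    refine Measure.integrableOn_of_bounded (M := ‖w‖ * h)
      (by rw [volume_cell hh]; exact ENNReal.ofReal_ne_top)
      (by fun_prop) ?_
    refine (ae_restrict_iff' (measurableSet_cell h)).2 (Eventually.of_forall fun q hq => ?_)
    refine (norm_inner_le_norm w q).trans ?_
    gcongr
    have := norm_sq_le_of_mem_cell hq
    nlinarith [norm_nonneg q]
  have hi : IntegrableOn (fun q : Plane => (1 : ℝ) - 2 * a * ⟪w, q⟫) (cell h) :=
    (integrable_const _).sub (hin.const_mul _)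
  have hval : ∫ q in cell h, ((1 : ℝ) - 2 * a * ⟪w, q⟫) = h ^ 2 := by
    rw [integral_sub (integrable_const _) (hin.const_mul _), integral_const_mul,
      integral_inner_cell]
    simp [measureReal_def, volume_cell hh, hh.le]
  have hgi : IntegrableOn (fun q : Plane => Real.exp (-a * ‖w + q‖ ^ 2)) (cell h) := by
    have := integrable_exp_neg_mul_sq_norm_sub ha (-w)
    simp only [sub_neg_eq_add] at this
    simpa only [add_comm w] using this.integrableOn
  -- Expand |w+q|², use 1 + x ≤ exp x on the cross term and |q|² ≤ h²/2 on the last; the cross term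
  -- then averages to zero.
  have hle : ∫ q in cell h, Real.exp (-a * ‖w‖ ^ 2) * ((1 : ℝ) - 2 * a * ⟪w, q⟫) ≤
      ∫ q in cell h, Real.exp (a * h ^ 2 / 2) * Real.exp (-a * ‖w + q‖ ^ 2) := by
    refine setIntegral_mono_on (hi.const_mul _) (hgi.const_mul _) (measurableSet_cell h)
      fun q hq => ?_
    have h1 : (1 : ℝ) - 2 * a * ⟪w, q⟫ ≤ Real.exp (-(2 * a * ⟪w, q⟫)) := by
      have := Real.add_one_le_exp (-(2 * a * ⟪w, q⟫)); linarith
    refine (mul_le_mul_of_nonneg_left h1 (Real.exp_pos _).le).trans ?_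
    rw [← Real.exp_add, ← Real.exp_add, norm_add_sq_real]
    refine Real.exp_le_exp.2 ?_
    have := mul_le_mul_of_nonneg_left (norm_sq_le_of_mem_cell hq) ha.le
    linarith
  rw [integral_const_mul, integral_const_mul, hval] at hle
  linarith

/-- The point `(h k₁, h k₂)` of the square lattice. -/
def latticePt (h : ℝ) (k : ℤ × ℤ) : Plane := !₂[h * k.1, h * k.2]

theorem latticePt_zero (h : ℝ) (k : ℤ × ℤ) : latticePt h k 0 = h * k.1 := rfl
theorem latticePt_one (h : ℝ) (k : ℤ × ℤ) : latticePt h k 1 = h * k.2 := rfl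

theorem latticePt_mem (h : ℝ) (k : ℤ × ℤ) : latticePt h k ∈ squareLattice h := by
  intro i
  fin_cases i
  · exact ⟨k.1, rfl⟩
  · exact ⟨k.2, rfl⟩

/-- Coordinatewise disjointness of the open cells around distinct lattice points. -/
theorem eq_of_abs_sub_lt {h x : ℝ} (hh : 0 < h) {k l : ℤ} (hk : |x - h * k| < h / 2)
    (hl : |x - h * l| < h / 2) : k = l := by
  rw [abs_lt] at hk hl
  have h1 : h * ((k : ℝ) - l) < h * 1 := by linarith
  have h2 : h * ((l : ℝ) - k) < h * 1 := by linarith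
  have h3 := lt_of_mul_lt_mul_left h1 hh.le
  have h4 := lt_of_mul_lt_mul_left h2 hh.le
  have h5 : k - l < 1 := by exact_mod_cast h3
  have h6 : l - k < 1 := by exact_mod_cast h4
  omega

/-- Gaussian sums over lattice points at distance at least `ρ + h/√2` from `X`, compared with the
Gaussian integral outside the disc of radius `ρ`. -/
theorem sum_gaussian_lattice_le {a h ρ : ℝ} (ha : 0 < a) (hh : 0 < h) (hρ : 0 ≤ ρ) (X : Plane)
    (T : Finset (ℤ × ℤ)) (hT : ρ = 0 ∨ ∀ k ∈ T, ρ + h / √2 ≤ ‖latticePt h k - X‖) :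
    h ^ 2 * ∑ k ∈ T, Real.exp (-a * ‖latticePt h k - X‖ ^ 2) ≤
      Real.exp (a * h ^ 2 / 2) * (Real.pi / a * Real.exp (-a * ρ ^ 2)) := by
  set w : ℤ × ℤ → Plane := fun k => latticePt h k - X with hw
  set g : Plane → ℝ := fun x => Real.exp (-a * ‖x‖ ^ 2) with hg
  have hgint : Integrable g := by simpa only [sub_zero] using integrable_exp_neg_mul_sq_norm_sub ha (0 : Plane)
  have hcell : ∀ k, ∫ q in cell h, g (w k + q) =
      ∫ x, (cell h).indicator (fun _ => (1 : ℝ)) (x - w k) * g x := by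
    intro k
    rw [← integral_indicator (measurableSet_cell h),
      ← integral_sub_right_eq_self (fun q => (cell h).indicator (fun q => g (w k + q)) q) (w k)]
    congr 1
    ext x
    by_cases hx : x - w k ∈ cell h
    · simp [Set.indicator_of_mem hx]
    · simp [Set.indicator_of_notMem hx]
  have hint : ∀ k, Integrable fun x => (cell h).indicator (fun _ => (1 : ℝ)) (x - w k) * g x := by
    intro k
    refine hgint.bdd_mul (c := 1) ?_ (Eventually.of_forall fun x => ?_)
    · exact ((measurable_const.indicator (measurableSet_cell h)).comp
        (measurable_id.sub_const _)).aestronglyMeasurable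
    · by_cases hx : x - w k ∈ cell h
      · simp [Set.indicator_of_mem hx]
      · simp [Set.indicator_of_notMem hx]
  have hgi : Integrable fun x : Plane =>
      (Set.Ioi ρ).indicator (fun y => Real.exp (-a * y ^ 2)) ‖x‖ := by
    refine hgint.mono' ?_ (Eventually.of_forall fun x => ?_)
    · exact ((Measurable.indicator (by fun_prop) measurableSet_Ioi).comp
        measurable_norm).aestronglyMeasurable
    · by_cases hx : ‖x‖ ∈ Set.Ioi ρ
      · simp [Set.indicator_of_mem hx, hg]
      · simp [Set.indicator_of_notMem hx, hg, (Real.exp_pos _).le]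
  calc h ^ 2 * ∑ k ∈ T, g (w k)
      = ∑ k ∈ T, h ^ 2 * g (w k) := Finset.mul_sum _ _ _
    _ ≤ ∑ k ∈ T, Real.exp (a * h ^ 2 / 2) * ∫ q in cell h, g (w k + q) :=
        Finset.sum_le_sum fun k _ => gaussian_le_integral_cell ha hh (w k)
    _ = Real.exp (a * h ^ 2 / 2) *
        ∫ x, ∑ k ∈ T, (cell h).indicator (fun _ => (1 : ℝ)) (x - w k) * g x := by
        rw [← Finset.mul_sum, integral_finsetSum _ fun k _ => hint k]
        simp_rw [hcell]
    _ ≤ Real.exp (a * h ^ 2 / 2) *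
        ∫ x : Plane, (Set.Ioi ρ).indicator (fun y => Real.exp (-a * y ^ 2)) ‖x‖ := by
        refine mul_le_mul_of_nonneg_left (integral_mono_ae
          (integrable_finsetSum _ fun k _ => hint k) hgi ?_) (Real.exp_pos _).le
        -- For ρ = 0 the indicator of `Set.Ioi 0` misses only the origin, a null set.
        have hne : ∀ᵐ x : Plane, x ≠ 0 := by
          simp [ae_iff]
        filter_upwards [hne] with x hx0
        by_cases hex : ∃ k ∈ T, x - w k ∈ cell h
        · obtain ⟨k, hk, hxk⟩ := hex
          rw [Finset.sum_eq_single k]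
          · have hmem : ‖x‖ ∈ Set.Ioi ρ := by
              rcases hT with hT | hT
              · rw [hT]; exact norm_pos_iff.2 hx0
              · have h1 := hT k hk
                have h2 : ‖w k‖ ≤ ‖x‖ + ‖x - w k‖ := by
                  have : w k = x - (x - w k) := by abel
                  nth_rewrite 1 [this]
                  exact norm_sub_le _ _
                have h3 : ‖x - w k‖ < h / √2 := by
                  have h0 := sq_lt_sq' (abs_lt.1 (hxk 0)).1 (abs_lt.1 (hxk 0)).2
                  have h1 := sq_lt_sq' (abs_lt.1 (hxk 1)).1 (abs_lt.1 (hxk 1)).2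
                  refine lt_of_pow_lt_pow_left₀ 2 (by positivity) ?_
                  rw [norm_sq_plane, div_pow, Real.sq_sqrt zero_le_two]
                  linarith
                show ρ < ‖x‖
                change ρ + h / √2 ≤ ‖w k‖ at h1
                linarith
            rw [Set.indicator_of_mem hxk, Set.indicator_of_mem hmem, one_mul]
          · intro l hl hlk
            have : x - w l ∉ cell h := by
              intro hxl
              apply hlk
              have e0 := hxk 0
              have e1 := hxk 1
              have f0 := hxl 0
              have f1 := hxl 1
              simp only [hw, PiLp.sub_apply, latticePt_zero, latticePt_one] at e0 e1 f0 f1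
              refine Prod.ext (eq_of_abs_sub_lt (x := x 0 + X 0) hh ?_ ?_)
                (eq_of_abs_sub_lt (x := x 1 + X 1) hh ?_ ?_)
              · convert f0 using 2; ring
              · convert e0 using 2; ring
              · convert f1 using 2; ring
              · convert e1 using 2; ring
            rw [Set.indicator_of_notMem this, zero_mul]
          · exact fun h => absurd hk h
        · push Not at hex
          rw [Finset.sum_eq_zero fun k hk => by rw [Set.indicator_of_notMem (hex k hk), zero_mul]]
          exact Set.indicator_nonneg (fun _ _ => (Real.exp_pos _).le) _
    _ = _ := by rw [integral_gaussian_outside_disc ha hρ]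

/-- Gaussian sums over a one-dimensional lattice. -/
theorem sq_sum_gaussian_int_le {a h : ℝ} (ha : 0 < a) (hh : 0 < h) (x : ℝ) (T : Finset ℤ) :
    (h * ∑ k ∈ T, Real.exp (-a * (h * k - x) ^ 2)) ^ 2 ≤
      Real.exp (a * h ^ 2 / 2) * (Real.pi / a) := by
  -- On a product set, centred on the diagonal, the planar sum is the square of the linear one.
  have h1 := sum_gaussian_lattice_le ha hh le_rfl (!₂[x, x] : Plane) (T ×ˢ T) (Or.inl rfl)
  simp only [ne_eq, OfNat.ofNat_ne_zero, not_false_eq_true, zero_pow, mul_zero, Real.exp_zero,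
    mul_one] at h1
  refine le_trans (le_of_eq ?_) h1
  rw [mul_pow, sq (∑ k ∈ T, _), Finset.sum_mul_sum, Finset.sum_product]
  congr 1
  refine Finset.sum_congr rfl fun k _ => Finset.sum_congr rfl fun l _ => ?_
  rw [← Real.exp_add, norm_sq_plane]
  congr 1
  simp [latticePt]
  ring

/-- Used to add up the aliases in Poisson summation; the constant comes from π√e ≤ 9. -/
theorem sum_exp_neg_sq_int_le (T : Finset ℤ) : ∑ m ∈ T, Real.exp (-(m : ℝ) ^ 2) ≤ 3 := by
  have h := sq_sum_gaussian_int_le one_pos one_pos 0 T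
  simp only [one_mul, sub_zero, neg_mul, one_pow, div_one] at h
  have h2 : Real.exp (1 / 2) ≤ 2 := by
    have h3 : Real.exp (1 / 2) ^ 2 = Real.exp 1 := by
      rw [← Real.exp_nat_mul]; norm_num
    have := Real.exp_one_lt_d9
    nlinarith [Real.exp_pos (1 / 2)]
  have h4 : (∑ m ∈ T, Real.exp (-(m : ℝ) ^ 2)) ^ 2 ≤ 3 ^ 2 := by
    nlinarith [Real.pi_lt_d2, Real.pi_pos]
  exact le_of_sq_le_sq h4 (by norm_num)

theorem summable_exp_neg_sq_int : Summable fun m : ℤ => Real.exp (-(m : ℝ) ^ 2) :=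
  summable_of_sum_le (fun _ => (Real.exp_pos _).le) sum_exp_neg_sq_int_le

theorem tsum_exp_neg_sq_int_le : ∑' m : ℤ, Real.exp (-(m : ℝ) ^ 2) ≤ 3 :=
  summable_exp_neg_sq_int.tsum_le_of_sum_le sum_exp_neg_sq_int_le

/-! ### Poisson summation and the trapezoidal rule in one variable. -/

/-- The character `x ↦ exp(-2πi x ξ)`. -/
def char (ξ x : ℝ) : ℂ := Complex.exp ((-2 * Real.pi * x * ξ : ℝ) * Complex.I)

theorem norm_char (ξ x : ℝ) : ‖char ξ x‖ = 1 := Complex.norm_exp_ofReal_mul_I _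

theorem continuous_char (ξ : ℝ) : Continuous (char ξ) := by
  unfold char; fun_prop

theorem fourier_eq_integral_char (f : ℝ → ℂ) (ξ : ℝ) : 𝓕 f ξ = ∫ x, char ξ x * f x := by
  rw [Real.fourier_real_eq_integral_exp_smul]
  rfl

/-- Supplies the polynomial decay that the Poisson summation formula requires. -/
theorem isBigO_exp_neg_mul_sq {α x₀ : ℝ} (hα : 0 < α) {s : ℝ} (hs : 0 < s) (b : ℝ) :
    (fun x : ℝ => Real.exp (-α * (s * x - x₀) ^ 2)) =O[cocompact ℝ] fun x => |x| ^ b := by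
  have h := (cexp_neg_quadratic_isLittleO_abs_rpow_cocompact (a := ((-α * s ^ 2 : ℝ) : ℂ))
    (by rw [Complex.ofReal_re]; have := mul_pos hα (pow_pos hs 2); linarith)
    ((2 * α * s * x₀ : ℝ) : ℂ) b).isBigO
  refine Asymptotics.IsBigO.trans (Asymptotics.IsBigO.of_bound (Real.exp (-α * x₀ ^ 2))
    (Eventually.of_forall fun x => ?_)) h
  rw [Complex.norm_exp, Real.norm_eq_abs, abs_of_pos (Real.exp_pos _), ← Real.exp_add]
  refine Real.exp_le_exp.2 (le_of_eq ?_)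
  have : ((((-α * s ^ 2 : ℝ) : ℂ) * (x : ℂ) ^ 2 + ((2 * α * s * x₀ : ℝ) : ℂ) * x)).re =
      -α * s ^ 2 * x ^ 2 + 2 * α * s * x₀ * x := by
    rw [show (((-α * s ^ 2 : ℝ) : ℂ) * (x : ℂ) ^ 2 + ((2 * α * s * x₀ : ℝ) : ℂ) * x) =
      ((-α * s ^ 2 * x ^ 2 + 2 * α * s * x₀ * x : ℝ) : ℂ) by push_cast; ring, Complex.ofReal_re]
  rw [this]
  ring

/-- The quadrature error of the trapezoidal rule for the Fourier integral, by Poisson summation. -/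
theorem GaussianExt.trapezoidal_error {h : ℝ → ℝ → ℂ} {x₀ C α β : ℝ}
    (hh : GaussianExt h x₀ C α β) (hα : 0 < α) (hβ : 0 < β) {s ξ ε : ℝ} (hs : 0 < s)
    (hdec : ∀ m : ℤ, m ≠ 0 →
      Real.exp (-(Real.pi ^ 2 / β) * (ξ + m / s) ^ 2) ≤ ε * Real.exp (-(m : ℝ) ^ 2)) :
    ‖𝓕 (fun x => h x 0) ξ - s * ∑' k : ℤ, char ξ (s * k) * h (s * k) 0‖ ≤
      C * √(Real.pi / α) * (3 * ε) := by
  have hC := hh.nonneg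
  set g : ℝ → ℂ := fun x => char ξ (s * x) * h (s * x) 0 with hg
  have hgc : Continuous g :=
    ((continuous_char ξ).comp (by fun_prop)).mul ((hh.cont 0).comp (by fun_prop))
  have hgO : g =O[cocompact ℝ] fun x => |x| ^ (-2 : ℝ) := by
    refine Asymptotics.IsBigO.trans (Asymptotics.IsBigO.of_bound C
      (Eventually.of_forall fun x => ?_)) (isBigO_exp_neg_mul_sq (x₀ := x₀) hα hs (-2))
    rw [hg, norm_mul, norm_char, one_mul, Real.norm_eq_abs (Real.exp _),
      abs_of_pos (Real.exp_pos _)]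
    simpa using hh.bound (s * x) 0
  -- Rescaling by s turns integer frequencies of the sampled function into the aliases ξ + m/s.
  have hF : ∀ m : ℤ, 𝓕 g m = (s⁻¹ : ℝ) * 𝓕 (fun x => h x 0) (ξ + m / s) := by
    intro m
    rw [fourier_eq_integral_char, fourier_eq_integral_char]
    have := Measure.integral_comp_mul_left (fun t => char (ξ + m / s) t * h t 0) s
    rw [abs_of_pos (inv_pos.2 hs), Complex.real_smul] at this
    rw [← this]
    congr 1
    ext x
    rw [hg, ← mul_assoc]
    congr 1
    simp only [char]
    rw [← Complex.exp_add]
    congr 1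
    have hs' : (s : ℂ) ≠ 0 := by exact_mod_cast hs.ne'
    push_cast
    field_simp
    ring
  have hFb : ∀ m : ℤ, m ≠ 0 → ‖𝓕 g m‖ ≤ s⁻¹ * (C * √(Real.pi / α) * ε) * Real.exp (-(m : ℝ) ^ 2) := by
    intro m hm
    rw [hF, norm_mul, Complex.norm_real, Real.norm_eq_abs, abs_of_pos (inv_pos.2 hs)]
    have h1 := hh.norm_fourier_le hα hβ (ξ + m / s)
    simp only [Module.finrank_self, Nat.cast_one, ← Real.sqrt_eq_rpow, Real.norm_eq_abs,
      sq_abs] at h1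
    have h2 := mul_le_mul_of_nonneg_left (hdec m hm)
      (mul_nonneg hC (Real.sqrt_nonneg (Real.pi / α)))
    have h3 := mul_le_mul_of_nonneg_left (h1.trans h2) (inv_pos.2 hs).le
    refine h3.trans (le_of_eq (by ring))
  have hsum0 : Summable fun m : ℤ => ‖if m = 0 then 0 else 𝓕 g m‖ := by
    refine Summable.of_nonneg_of_le (fun _ => norm_nonneg _) (fun m => ?_)
      (summable_exp_neg_sq_int.mul_left (s⁻¹ * (C * √(Real.pi / α) * |ε|)))
    split_ifs with hm
    · rw [norm_zero]; positivity
    · refine (hFb m hm).trans ?_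
      gcongr
      exact le_abs_self ε
  have hsum : Summable fun m : ℤ => 𝓕 g m := by
    have := hsum0.of_norm.add (summable_of_hasFiniteSupport
      (f := fun m : ℤ => if m = 0 then 𝓕 g m else 0) ((Set.finite_singleton (0 : ℤ)).subset fun m hm => by
        by_contra h
        exact hm (if_neg h)))
    refine this.congr fun m => ?_
    split_ifs <;> simp
  have hP := Real.tsum_eq_tsum_fourier_of_rpow_decay_of_summable hgc one_lt_two hgO hsum 0
  simp only [zero_add, QuotientAddGroup.mk_zero, fourier_eval_zero, mul_one] at hP
  -- The term m = 0 is the Fourier integral sought; all other terms are the quadrature error.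
  rw [hsum.tsum_eq_add_tsum_ite 0] at hP
  have hε3 : ‖∑' m : ℤ, if m = 0 then 0 else 𝓕 g m‖ ≤ s⁻¹ * (C * √(Real.pi / α) * (3 * ε)) := by
    have hε : 0 ≤ ε := by
      have := (Real.exp_pos _).le.trans (hdec 1 one_ne_zero)
      exact nonneg_of_mul_nonneg_left this (Real.exp_pos _)
    refine (norm_tsum_le_tsum_norm hsum0).trans ?_
    refine (hsum0.tsum_le_tsum (fun m => ?_)
      (summable_exp_neg_sq_int.mul_left (s⁻¹ * (C * √(Real.pi / α) * ε)))).trans ?_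
    · split_ifs with hm
      · rw [norm_zero]; positivity
      · exact hFb m hm
    · rw [tsum_mul_left]
      refine (mul_le_mul_of_nonneg_left tsum_exp_neg_sq_int_le (by positivity)).trans
        (le_of_eq (by ring))
  have h0 : 𝓕 g ((0 : ℤ) : ℝ) = (s⁻¹ : ℝ) * 𝓕 (fun x => h x 0) ξ := by
    simpa using hF 0
  have hs' : (s : ℂ) ≠ 0 := by exact_mod_cast hs.ne'
  have e : 𝓕 (fun x => h x 0) ξ - s * ∑' k : ℤ, char ξ (s * k) * h (s * k) 0 =
      -(s * ∑' m : ℤ, if m = 0 then 0 else 𝓕 g m) := by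
    change 𝓕 (fun x => h x 0) ξ - s * ∑' k : ℤ, g k = _
    rw [hP, h0, mul_add]
    push_cast
    rw [← mul_assoc, mul_inv_cancel₀ hs']
    ring
  rw [e, norm_neg, norm_mul, Complex.norm_real, Real.norm_eq_abs, abs_of_pos hs]
  refine (mul_le_mul_of_nonneg_left hε3 hs.le).trans (le_of_eq ?_)
  rw [← mul_assoc, mul_inv_cancel₀ hs.ne', one_mul]

/-! ### The trapezoidal rule in the plane, one variable at a time. -/

theorem norm_sq_vec (a b : ℝ) : ‖(!₂[a, b] : Plane)‖ ^ 2 = a ^ 2 + b ^ 2 := by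
  rw [norm_sq_plane]; simp

theorem continuous_vec_left (t : ℝ) : Continuous fun x : ℝ => (!₂[x, t] : Plane) :=
  (PiLp.continuous_toLp 2 _).comp (by fun_prop)

theorem continuous_vec_right (t : ℝ) : Continuous fun x : ℝ => (!₂[t, x] : Plane) :=
  (PiLp.continuous_toLp 2 _).comp (by fun_prop)

/-- Freezing one variable puts its Gaussian into the constant, so that one-variable errors remain
summable and integrable over the frozen variable. -/
theorem GaussianExt.slice_left {H : Plane → Plane → ℂ} {X : Plane} {C α β : ℝ}
    (hH : GaussianExt H X C α β) (t : ℝ) :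
    GaussianExt (fun x y : ℝ => H !₂[x, t] !₂[y, 0]) (X 0)
      (C * Real.exp (-α * (t - X 1) ^ 2)) α β where
  cont y := (hH.cont _).comp (continuous_vec_left t)
  hol x v := by
    obtain ⟨g, hg, hgH⟩ := hH.hol !₂[x, t] !₂[v, 0]
    refine ⟨g, hg, fun τ => ?_⟩
    rw [hgH]
    congr 1 <;> ext i <;> fin_cases i <;> simp
  bound x y := by
    refine (hH.bound _ _).trans (le_of_eq ?_)
    rw [mul_assoc, ← Real.exp_add, norm_sq_plane, norm_sq_plane]
    simp only [PiLp.sub_apply, Real.norm_eq_abs, sq_abs]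
    congr 2
    simp
    ring

theorem GaussianExt.slice_right {H : Plane → Plane → ℂ} {X : Plane} {C α β : ℝ}
    (hH : GaussianExt H X C α β) (t : ℝ) :
    GaussianExt (fun x y : ℝ => H !₂[t, x] !₂[0, y]) (X 1)
      (C * Real.exp (-α * (t - X 0) ^ 2)) α β where
  cont y := (hH.cont _).comp (continuous_vec_right t)
  hol x v := by
    obtain ⟨g, hg, hgH⟩ := hH.hol !₂[t, x] !₂[0, v]
    refine ⟨g, hg, fun τ => ?_⟩
    rw [hgH]
    congr 1 <;> ext i <;> fin_cases i <;> simp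
  bound x y := by
    refine (hH.bound _ _).trans (le_of_eq ?_)
    rw [mul_assoc, ← Real.exp_add, norm_sq_plane, norm_sq_plane]
    simp only [PiLp.sub_apply, Real.norm_eq_abs, sq_abs]
    congr 2
    simp
    ring

theorem vec_zero : (!₂[(0 : ℝ), 0] : Plane) = 0 := by
  ext i; fin_cases i <;> simp

/-- The identification of `ℝ × ℝ` with the plane. -/
def prodToPlane : ℝ × ℝ ≃ᵐ Plane :=
  (MeasurableEquiv.finTwoArrow (α := ℝ)).symm.trans (MeasurableEquiv.toLp 2 (Fin 2 → ℝ))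

theorem measurePreserving_prodToPlane : MeasurePreserving prodToPlane volume volume :=
  (PiLp.volume_preserving_toLp (Fin 2)).comp (volume_preserving_finTwoArrow ℝ).symm

theorem integrable_comp_prodToPlane {F : Plane → ℂ} (hF : Integrable F) :
    Integrable (fun x : ℝ × ℝ => F !₂[x.1, x.2]) (volume.prod volume) :=
  (measurePreserving_prodToPlane.integrable_comp_emb prodToPlane.measurableEmbedding).2 hF

theorem integral_plane {F : Plane → ℂ} (hF : Integrable F) :
    ∫ x, F x = ∫ t : ℝ, ∫ x : ℝ, F !₂[x, t] := by
  rw [← measurePreserving_prodToPlane.integral_comp prodToPlane.measurableEmbedding]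
  exact integral_prod_symm _ (integrable_comp_prodToPlane hF)

theorem fourier_plane {F : Plane → ℂ} (hF : Integrable F) (ξ : Plane) :
    𝓕 F ξ = ∫ t : ℝ, char (ξ 1) t * 𝓕 (fun x : ℝ => F !₂[x, t]) (ξ 0) := by
  rw [Real.fourier_eq']
  have hint : Integrable fun x : Plane =>
      Complex.exp ((-2 * Real.pi * ⟪x, ξ⟫ : ℝ) * Complex.I) • F x := by
    simp only [smul_eq_mul]
    refine hF.bdd_mul (c := 1) (Continuous.aestronglyMeasurable (by fun_prop))
      (Eventually.of_forall fun x => ?_)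
    rw [Complex.norm_exp_ofReal_mul_I]
  rw [integral_plane hint]
  congr 1
  ext t
  rw [fourier_eq_integral_char, ← integral_const_mul]
  congr 1
  ext x
  rw [smul_eq_mul, ← mul_assoc]
  congr 1
  simp only [char]
  rw [← Complex.exp_add]
  congr 1
  simp [PiLp.inner_apply, Fin.sum_univ_two]
  ring

theorem fourier_slice_integrable {F : Plane → ℂ} (hF : Integrable F) (ξ : Plane) :
    Integrable fun t : ℝ => char (ξ 1) t * 𝓕 (fun x : ℝ => F !₂[x, t]) (ξ 0) := by
  have h1 : Integrable (fun x : ℝ × ℝ => char (ξ 0) x.1 * F !₂[x.1, x.2])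
      (volume.prod volume) := by
    refine (integrable_comp_prodToPlane hF).bdd_mul (c := 1)
      ((continuous_char _).comp continuous_fst).aestronglyMeasurable
      (Eventually.of_forall fun x => (norm_char _ _).le)
  have h2 := h1.integral_prod_right
  refine Integrable.bdd_mul (c := 1) ?_ (continuous_char _).aestronglyMeasurable
      (Eventually.of_forall fun x => (norm_char _ _).le)
  simpa only [fourier_eq_integral_char] using h2

/-- The Fourier transform of a Gaussian-localized function at low frequencies is controlled by its
lattice samples, up to an aliasing error. -/
theorem GaussianExt.norm_fourier_le_of_samples {H : Plane → Plane → ℂ} {X : Plane} {C α β : ℝ}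
    (hH : GaussianExt H X C α β) (hα : 0 < α) (hβ : 0 < β) {s ε N M : ℝ} (hs : 0 < s)
    (ξ : Plane)
    (hdec : ∀ (i : Fin 2) (m : ℤ), m ≠ 0 →
      Real.exp (-(Real.pi ^ 2 / β) * (ξ i + m / s) ^ 2) ≤ ε * Real.exp (-(m : ℝ) ^ 2))
    (hN : ∀ T : Finset (ℤ × ℤ), s ^ 2 * ∑ k ∈ T, ‖H (latticePt s k) 0‖ ≤ N)
    (hM : ∀ T : Finset ℤ, s * ∑ k ∈ T, Real.exp (-α * (s * k - X 0) ^ 2) ≤ M) :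
    ‖𝓕 (fun x => H x 0) ξ‖ ≤ N + C * √(Real.pi / α) * (3 * ε) * (√(Real.pi / α) + M) := by
  have hC := hH.nonneg
  have hε : 0 ≤ ε := by
    have := (Real.exp_pos _).le.trans (hdec 0 1 one_ne_zero)
    exact nonneg_of_mul_nonneg_left this (Real.exp_pos _)
  set r := √(Real.pi / α) with hr
  have hr0 : 0 ≤ r := Real.sqrt_nonneg _
  have hsE : Summable fun k : ℤ => Real.exp (-α * (s * k - X 0) ^ 2) :=
    summable_of_sum_le (c := M / s) (fun _ => (Real.exp_pos _).le) fun T => by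
      rw [le_div_iff₀ hs, mul_comm]; exact hM T
  have hsEM : s * ∑' k : ℤ, Real.exp (-α * (s * k - X 0) ^ 2) ≤ M := by
    rw [← le_div_iff₀' hs]
    exact hsE.tsum_le_of_sum_le fun T => by rw [le_div_iff₀' hs]; exact hM T
  have hsH : Summable fun k : ℤ × ℤ => ‖H !₂[s * k.1, s * k.2] 0‖ :=
    summable_of_sum_le (c := N / s ^ 2) (fun _ => norm_nonneg _) fun T => by
      rw [le_div_iff₀' (by positivity)]; exact hN T
  have hsHN : s ^ 2 * ∑' k : ℤ × ℤ, ‖H !₂[s * k.1, s * k.2] 0‖ ≤ N := by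
    rw [← le_div_iff₀' (by positivity)]
    exact hsH.tsum_le_of_sum_le fun T => by rw [le_div_iff₀' (by positivity)]; exact hN T
  have hint0 : Integrable fun x => H x 0 := hH.integrable hα 0
  have hbd : ∀ x t : ℝ, ‖H !₂[x, t] 0‖ ≤
      C * Real.exp (-α * (t - X 1) ^ 2) * Real.exp (-α * (x - X 0) ^ 2) := by
    intro x t
    refine (hH.bound _ _).trans (le_of_eq ?_)
    rw [mul_assoc, ← Real.exp_add, norm_sq_plane]
    congr 2
    simp
    ring
  have hgt : Integrable fun t : ℝ => Real.exp (-α * (t - X 1) ^ 2) := by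
    simpa only [Real.norm_eq_abs, sq_abs] using integrable_exp_neg_mul_sq_norm_sub hα (X 1)
  have hgtI : ∫ t : ℝ, Real.exp (-α * (t - X 1) ^ 2) = r := by
    have := integral_exp_neg_mul_sq_norm_sub hα (X 1)
    simpa only [Real.norm_eq_abs, sq_abs, Module.finrank_self, Nat.cast_one,
      ← Real.sqrt_eq_rpow] using this
  have hchar : ∀ (a x : ℝ) (z : ℂ), ‖char a x * z‖ = ‖z‖ := fun a x z => by
    rw [norm_mul, norm_char, one_mul]
  -- the trapezoidal rule in the first variable
  set A : ℝ → ℂ := fun t => char (ξ 1) t * 𝓕 (fun x : ℝ => H !₂[x, t] 0) (ξ 0) with hA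
  set G : ℤ → ℝ → ℂ := fun k t =>
    char (ξ 1) t * (s * (char (ξ 0) (s * k) * H !₂[s * k, t] 0)) with hG
  have hGn : ∀ k t, ‖G k t‖ = s * ‖H !₂[s * k, t] 0‖ := fun k t => by
    rw [hG]
    simp only [hchar, norm_mul, Complex.norm_real, Real.norm_eq_abs,
      abs_of_pos hs]
  have hGb : ∀ k t, ‖G k t‖ ≤ s * C * Real.exp (-α * (s * k - X 0) ^ 2) *
      Real.exp (-α * (t - X 1) ^ 2) := fun k t => by
    rw [hGn]
    refine (mul_le_mul_of_nonneg_left (hbd _ _) hs.le).trans (le_of_eq (by ring))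
  have hGc : ∀ k, Continuous (G k) := fun k =>
    (continuous_char _).mul (continuous_const.mul (continuous_const.mul
      ((hH.cont 0).comp (continuous_vec_right _))))
  have hGi : ∀ k, Integrable (G k) := fun k =>
    (hgt.const_mul (s * C * Real.exp (-α * (s * k - X 0) ^ 2))).mono'
      (hGc k).aestronglyMeasurable (Eventually.of_forall fun t => hGb k t)
  have hAint : Integrable A := fourier_slice_integrable hint0 ξ
  have hstep : ∀ t, ‖A t - ∑' k, G k t‖ ≤ C * r * (3 * ε) * Real.exp (-α * (t - X 1) ^ 2) := by
    intro t
    have h1 := (hH.slice_left t).trapezoidal_error hα hβ (ξ := ξ 0) (ε := ε) hs (hdec 0)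
    simp only [vec_zero] at h1
    have h2 : A t - ∑' k, G k t = char (ξ 1) t * (𝓕 (fun x : ℝ => H !₂[x, t] 0) (ξ 0) -
        s * ∑' k : ℤ, char (ξ 0) (s * k) * H !₂[s * k, t] 0) := by
      simp only [hA, hG]
      rw [tsum_mul_left, tsum_mul_left]
      ring
    rw [h2, hchar]
    exact h1.trans (le_of_eq (by ring))
  have hBc : Continuous fun t => ∑' k, G k t := by
    refine continuous_tsum hGc (hsE.mul_left (s * C)) fun k t => (hGb k t).trans ?_
    refine mul_le_of_le_one_right (by positivity) (Real.exp_le_one_iff.2 ?_)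
    nlinarith [sq_nonneg (t - X 1)]
  -- Integrability is inherited from `A` and from the Gaussian bound on the difference.
  have hBint : Integrable fun t => ∑' k, G k t := by
    have hd : Integrable fun t => A t - ∑' k, G k t :=
      (hgt.const_mul (C * r * (3 * ε))).mono'
        (hAint.aestronglyMeasurable.sub hBc.aestronglyMeasurable) (Eventually.of_forall hstep)
    refine (hAint.sub hd).congr (Eventually.of_forall fun t => ?_)
    simp
  have hfirst : ‖𝓕 (fun x => H x 0) ξ - ∫ t, ∑' k, G k t‖ ≤ C * r * (3 * ε) * r := by
    rw [fourier_plane hint0, ← integral_sub hAint hBint]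
    refine (norm_integral_le_of_norm_le (hgt.const_mul (C * r * (3 * ε)))
      (Eventually.of_forall hstep)).trans (le_of_eq ?_)
    rw [integral_const_mul, hgtI]
  -- the trapezoidal rule in the second variable
  have hGnorm : Summable fun k => ∫ t, ‖G k t‖ := by
    refine Summable.of_nonneg_of_le (fun k => integral_nonneg fun t => norm_nonneg _)
      (fun k => ?_) ((hsE.mul_left (s * C)).mul_right r)
    rw [← hgtI, ← integral_const_mul]
    exact integral_mono (hGi k).norm (hgt.const_mul _) fun t => hGb k t
  have hswap := integral_tsum_of_summable_integral_norm hGi hGnorm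
  have hk : ∀ k : ℤ, ‖∫ t, G k t‖ ≤ s ^ 2 * ∑' l : ℤ, ‖H !₂[s * k, s * l] 0‖ +
      s * (C * r * (3 * ε)) * Real.exp (-α * (s * k - X 0) ^ 2) := by
    intro k
    have h1 := (hH.slice_right (s * k)).trapezoidal_error hα hβ (ξ := ξ 1) (ε := ε) hs (hdec 1)
    simp only [vec_zero] at h1
    have h2 : ∫ t, G k t = s * (char (ξ 0) (s * k) * 𝓕 (fun t : ℝ => H !₂[s * k, t] 0) (ξ 1)) := by
      rw [fourier_eq_integral_char, ← integral_const_mul, ← integral_const_mul]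
      congr 1
      ext t
      simp only [hG]
      ring
    have hsl : Summable fun l : ℤ => ‖H !₂[s * k, s * l] 0‖ :=
      hsH.comp_injective (i := fun l : ℤ => (k, l)) fun _ _ h => (Prod.ext_iff.1 h).2
    have h3 : ‖s * ∑' l : ℤ, char (ξ 1) (s * l) * H !₂[s * k, s * l] 0‖ ≤
        s * ∑' l : ℤ, ‖H !₂[s * k, s * l] 0‖ := by
      rw [norm_mul, Complex.norm_real, Real.norm_eq_abs, abs_of_pos hs]
      refine mul_le_mul_of_nonneg_left ((norm_tsum_le_tsum_norm ?_).trans (le_of_eq ?_)) hs.le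
      · simpa only [hchar] using hsl
      · simp only [hchar]
    rw [h2, norm_mul, hchar, Complex.norm_real, Real.norm_eq_abs, abs_of_pos hs]
    have h4 := norm_le_norm_add_norm_sub' (𝓕 (fun t : ℝ => H !₂[s * k, t] 0) (ξ 1))
      (s * ∑' l : ℤ, char (ξ 1) (s * l) * H !₂[s * k, s * l] 0)
    have h5 := mul_le_mul_of_nonneg_left (h4.trans (add_le_add h3 h1)) hs.le
    exact h5.trans (le_of_eq (by ring))
  have hsl2 : Summable fun k : ℤ => ∑' l : ℤ, ‖H !₂[s * k, s * l] 0‖ := hsH.prod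
  have hsR : Summable fun k : ℤ => s ^ 2 * ∑' l : ℤ, ‖H !₂[s * k, s * l] 0‖ +
      s * (C * r * (3 * ε)) * Real.exp (-α * (s * k - X 0) ^ 2) :=
    (hsl2.mul_left _).add (hsE.mul_left _)
  have hsL : Summable fun k => ‖∫ t, G k t‖ :=
    Summable.of_nonneg_of_le (fun _ => norm_nonneg _) hk hsR
  have hsecond : ‖∫ t, ∑' k, G k t‖ ≤ N + C * r * (3 * ε) * M := by
    rw [← hswap]
    refine (norm_tsum_le_tsum_norm hsL).trans ((hsL.tsum_le_tsum hk hsR).trans ?_)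
    rw [(hsl2.mul_left _).tsum_add (hsE.mul_left _), tsum_mul_left, tsum_mul_left,
      ← hsH.tsum_prod]
    refine add_le_add hsHN ?_
    have := mul_le_mul_of_nonneg_left hsEM (by positivity : 0 ≤ C * r * (3 * ε))
    exact le_trans (le_of_eq (by ring)) this
  have := norm_le_norm_add_norm_sub' (𝓕 (fun x => H x 0) ξ) (∫ t, ∑' k, G k t)
  linarith

/-! ### Gaussian localization and Fourier inversion at complex points. -/

/-- The point `x + i y` of `ℂ²`. -/
def complexPt (x y : Plane) : Fin 2 → ℂ := fun i => (x i : ℂ) + Complex.I * (y i : ℂ)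

theorem complexPt_zero_right (x : Plane) : complexPt x 0 = toC x := by
  ext i; simp [complexPt, toC]

/-- `D(x + i y) exp(-π/8 (x + i y - X)²)`. -/
def localized (D : (Fin 2 → ℂ) → ℂ) (X x y : Plane) : ℂ :=
  D (complexPt x y) *
    Complex.exp (-(Real.pi / 8 : ℂ) * ∑ i : Fin 2, (complexPt x y i - (X i : ℂ)) ^ 2)

theorem norm_localized (D : (Fin 2 → ℂ) → ℂ) (X x y : Plane) :
    ‖localized D X x y‖ =
      ‖D (complexPt x y)‖ * Real.exp (-(Real.pi / 8) * ‖x - X‖ ^ 2 + Real.pi / 8 * ‖y‖ ^ 2) := by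
  rw [localized, norm_mul, Complex.norm_exp, norm_sq_plane, norm_sq_plane]
  congr 2
  have : -(Real.pi / 8 : ℂ) * ∑ i : Fin 2, (complexPt x y i - (X i : ℂ)) ^ 2 =
      ((-(Real.pi / 8) * ((x 0 - X 0) ^ 2 + (x 1 - X 1) ^ 2) +
        Real.pi / 8 * (y 0 ^ 2 + y 1 ^ 2) : ℝ) : ℂ) +
      ((-(Real.pi / 4) * ((x 0 - X 0) * y 0 + (x 1 - X 1) * y 1) : ℝ) : ℂ) * Complex.I := by
    simp only [Fin.sum_univ_two, complexPt]
    push_cast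
    linear_combination (-(Real.pi / 8 : ℂ) * (y 0 ^ 2 + y 1 ^ 2)) * Complex.I_sq
  rw [this, Complex.add_re, Complex.ofReal_re, Complex.re_ofReal_mul, Complex.I_re, mul_zero,
    add_zero]
  simp only [PiLp.sub_apply]

/-- The localizer contributes decay π/8 in real directions and costs π/8 in imaginary ones: 2π + π/8
= 17π/8. -/
theorem gaussianExt_localized {D : (Fin 2 → ℂ) → ℂ} (hD : Differentiable ℂ D) {c : ℝ}
    (hc : ∀ x y, ‖D (complexPt x y)‖ ≤ c * Real.exp (2 * Real.pi * ‖y‖ ^ 2)) (X : Plane) :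
    GaussianExt (localized D X) X c (Real.pi / 8) (17 * Real.pi / 8) where
  cont y := by
    have h1 : Continuous fun x : Plane => complexPt x y := by
      unfold complexPt; fun_prop
    unfold localized
    refine (hD.continuous.comp h1).mul (Complex.continuous_exp.comp ?_)
    simp only [Fin.sum_univ_two, complexPt]
    fun_prop
  hol x v := by
    have e : ∀ τ : ℂ, complexPt (x + τ.re • v) (τ.im • v) = fun i => (x i : ℂ) + τ * v i := by
      intro τ
      ext i
      simp only [complexPt, PiLp.add_apply, PiLp.smul_apply, smul_eq_mul]
      push_cast
      nth_rewrite 3 [← Complex.re_add_im τ]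
      ring
    refine ⟨fun τ => D (fun i => (x i : ℂ) + τ * v i) *
      Complex.exp (-(Real.pi / 8 : ℂ) * ∑ i : Fin 2, ((x i : ℂ) + τ * v i - (X i : ℂ)) ^ 2),
      ?_, fun τ => by simp only [localized, e]⟩
    refine Differentiable.mul (hD.comp ?_) ?_
    · rw [differentiable_pi]; intro i; fun_prop
    · simp only [Fin.sum_univ_two]; fun_prop
  bound x y := by
    rw [norm_localized]
    refine (mul_le_mul_of_nonneg_right (hc x y) (Real.exp_pos _).le).trans (le_of_eq ?_)
    rw [mul_assoc, ← Real.exp_add]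
    congr 2
    ring

/-- Fourier inversion at complex points for a function whose Fourier transform has Gaussian
decay. -/
theorem GaussianExt.norm_le_of_fourier_le {H : Plane → Plane → ℂ} {X : Plane} {C α β B γ : ℝ}
    (hH : GaussianExt H X C α β) (hα : 0 < α) (hβ : 0 < β) (hγ : 0 < γ)
    (hB : ∀ ξ, ‖𝓕 (fun x => H x 0) ξ‖ ≤ B * Real.exp (-γ * ‖ξ‖ ^ 2)) (x b : Plane) :
    ‖H x b‖ ≤ B * (Real.pi / γ) * Real.exp (Real.pi ^ 2 / γ * ‖b‖ ^ 2) := by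
  have hint : Integrable fun x => H x b := hH.integrable hα b
  -- Completing the square in -γ|ξ|² - 2π⟪b, ξ⟫ centres the Gaussian at -(π/γ)b.
  have hbound : ∀ ξ, ‖𝓕 (fun x => H x b) ξ‖ ≤ B * Real.exp (Real.pi ^ 2 / γ * ‖b‖ ^ 2) *
      Real.exp (-γ * ‖ξ - -(Real.pi / γ) • b‖ ^ 2) := by
    intro ξ
    rw [hH.fourier_shift hα hβ.le, norm_mul, Complex.norm_exp]
    refine (mul_le_mul_of_nonneg_left (hB ξ) (Real.exp_pos _).le).trans (le_of_eq ?_)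
    rw [mul_left_comm, mul_assoc B, ← Real.exp_add, ← Real.exp_add]
    congr 2
    rw [norm_sub_sq_real, real_inner_smul_right, norm_smul, mul_pow, Real.norm_eq_abs, sq_abs,
      real_inner_comm ξ b]
    simp
    field_simp
    ring
  have hgi := (integrable_exp_neg_mul_sq_norm_sub hγ (-(Real.pi / γ) • b)).const_mul
    (B * Real.exp (Real.pi ^ 2 / γ * ‖b‖ ^ 2))
  have hFc : Continuous (𝓕 (fun x => H x b)) := 
    VectorFourier.fourierIntegral_continuous Real.continuous_fourierChar
      (innerSL ℝ).continuous₂ hint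
  have hFi : Integrable (𝓕 (fun x => H x b)) :=
    hgi.mono' hFc.aestronglyMeasurable (Eventually.of_forall hbound)
  have hinv := hint.fourierInv_fourier_eq hFi (hH.cont b).continuousAt (v := x)
  rw [← hinv, Real.fourierInv_eq']
  refine (norm_integral_le_of_norm_le hgi (Eventually.of_forall fun ξ => ?_)).trans (le_of_eq ?_)
  · rw [norm_smul, Complex.norm_exp_ofReal_mul_I, one_mul]
    exact hbound ξ
  · rw [integral_const_mul, integral_exp_neg_mul_sq_norm_sub hγ]
    simp
    ring

/-! ### The stability estimate from lattice samples. -/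

theorem exp_le_of_le_sub {x y : ℝ} (h : (1 : ℝ) ≤ y * (1 - x)) (hx : x < 1) : Real.exp x ≤ y := by
  have h1 : 1 - x ≤ Real.exp (-x) := by have := Real.add_one_le_exp (-x); linarith
  have h2 : Real.exp x * Real.exp (-x) = 1 := by rw [← Real.exp_add]; simp
  have h3 : Real.exp x * (1 - x) ≤ y * (1 - x) :=
    ((mul_le_mul_of_nonneg_left h1 (Real.exp_pos x).le).trans h2.le).trans h
  exact le_of_mul_le_mul_right h3 (by linarith)

/-- The hypotheses on the mesh size `s` and the accuracy `ε` in squared form. -/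
theorem mesh_sq_mul_log_le {ε s : ℝ} (hε : 0 < ε) (hε' : ε < Real.exp (-1)) (hs : 0 < s)
    (hsε : s ≤ √(38 * Real.pi) / 36 * (Real.log (1 / ε)) ^ (-(1 / 2) : ℝ)) :
    1 < Real.log (1 / ε) ∧ s ^ 2 * Real.log (1 / ε) ≤ 38 * Real.pi / 1296 := by
  have hL : 1 < Real.log (1 / ε) := by
    rw [one_div, Real.log_inv]
    have := Real.log_lt_log hε hε'
    rw [Real.log_exp] at this
    linarith
  refine ⟨hL, ?_⟩
  set L := Real.log (1 / ε)
  have hL0 : 0 < L := by linarith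
  have h1 : s ^ 2 ≤ (√(38 * Real.pi) / 36 * L ^ (-(1 / 2) : ℝ)) ^ 2 := by gcongr
  have h2 : (L ^ (-(1 / 2) : ℝ)) ^ 2 = L⁻¹ := by
    rw [← Real.rpow_natCast, ← Real.rpow_mul hL0.le, ← Real.rpow_neg_one]
    norm_num
  rw [mul_pow, h2, div_pow, Real.sq_sqrt (by positivity)] at h1
  calc s ^ 2 * L ≤ 38 * Real.pi / 36 ^ 2 * L⁻¹ * L := by gcongr
    _ = 38 * Real.pi / 1296 := by field_simp; norm_num

/-- Aliases of a low frequency are negligible. -/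
theorem aliasing_decay {ε s t : ℝ} {m : ℤ} (hε : 0 < ε) (hL : 1 < Real.log (1 / ε)) (hs : 0 < s)
    (hsL : s ^ 2 * Real.log (1 / ε) ≤ 38 * Real.pi / 1296)
    (ht : Real.pi * t ^ 2 ≤ 17 / 8 * Real.log (1 / ε)) (hm : m ≠ 0) :
    Real.exp (-(Real.pi ^ 2 / (17 * Real.pi / 8)) * (t + m / s) ^ 2) ≤
      ε * Real.exp (-(m : ℝ) ^ 2) := by
  set L := Real.log (1 / ε) with hLdef
  have hεL : ε = Real.exp (-L) := by
    rw [hLdef, one_div, Real.log_inv, neg_neg, Real.exp_log hε]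
  have hπ := Real.pi_pos
  have hm1 : (1 : ℝ) ≤ (m : ℝ) ^ 2 := by
    have : (1 : ℤ) ≤ m ^ 2 := by have := sq_pos_of_ne_zero hm; omega
    exact_mod_cast this
  -- The mesh constant enters here: (17/8)(38/1296) is just below 1/16. Hence |st| ≤ |m|/4 and |st +
  -- m| ≥ 3|m|/4.
  have hst : (s * t) ^ 2 ≤ 1 / 16 := by
    have h1 : Real.pi * (s * t) ^ 2 ≤ Real.pi * (1 / 16) := by
      have := mul_le_mul_of_nonneg_left ht (sq_nonneg s)
      nlinarith
    exact le_of_mul_le_mul_left h1 hπ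
  have h2 : 9 / 16 * (m : ℝ) ^ 2 ≤ (s * t + m) ^ 2 := by
    have h3 : (s * t) ^ 2 ≤ (m / 4 : ℝ) ^ 2 := by nlinarith
    have h4 := sq_le_sq.1 h3
    have h5 : |(m : ℝ)| = 4 * |(m / 4 : ℝ)| := by rw [abs_div]; norm_num; ring
    have h6 : |(3 / 4 * m : ℝ)| ≤ |s * t + m| := by
      have h7 : |(m : ℝ)| ≤ |s * t + m| + |s * t| := by
        have := abs_sub (s * t + m) (s * t)
        simpa using this
      have h8 : |(3 / 4 * m : ℝ)| = 3 * |(m / 4 : ℝ)| := by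
        rw [show (3 / 4 * m : ℝ) = 3 * (m / 4) by ring, abs_mul]; norm_num
      linarith
    have := sq_le_sq.2 h6
    nlinarith
  have h3 : (t + m / s) ^ 2 = (s * t + m) ^ 2 / s ^ 2 := by field_simp
  have h4 : L * 1296 / (38 * Real.pi) ≤ 1 / s ^ 2 := by
    rw [div_le_div_iff₀ (by positivity) (by positivity)]
    linarith
  have h5 : 9 / 16 * (m : ℝ) ^ 2 * (L * 1296 / (38 * Real.pi)) ≤ (t + m / s) ^ 2 := by
    rw [h3, div_eq_mul_one_div _ (s ^ 2)]
    gcongr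
  rw [hεL, ← Real.exp_add]
  refine Real.exp_le_exp.2 ?_
  have h6 : Real.pi ^ 2 / (17 * Real.pi / 8) = 8 * Real.pi / 17 := by field_simp
  rw [h6]
  have h7 := mul_le_mul_of_nonneg_left h5 (by positivity : 0 ≤ 8 * Real.pi / 17)
  have h8 : 8 * Real.pi / 17 * (9 / 16 * (m : ℝ) ^ 2 * (L * 1296 / (38 * Real.pi))) =
      (8 * 9 * 1296 / (17 * 16 * 38)) * (L * (m : ℝ) ^ 2) := by field_simp
  rw [h8] at h7
  -- The numerical factor exceeds 9, while L > 1 and m² ≥ 1 give L + m² ≤ 2 L m².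
  nlinarith

/-- Lattice samples of the localized function: small on `Ω`, and Gaussian decay off `Ω`. -/
theorem sum_samples_le {H : Plane → Plane → ℂ} {X : Plane} {c β ε s : ℝ}
    (hH : GaussianExt H X c (Real.pi / 8) β) {Ω : Set Plane}
    (hε : 0 < ε) (hL : 1 < Real.log (1 / ε)) (hs : 0 < s)
    (hsL : s ^ 2 * Real.log (1 / ε) ≤ 38 * Real.pi / 1296)
    (hX : X ∈ interiorRegion s Ω)
    (hΩ : ∀ ω ∈ Ω, ‖H ω 0‖ ≤ ε * Real.exp (-(Real.pi / 8) * ‖ω - X‖ ^ 2))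
    (T : Finset (ℤ × ℤ)) :
    s ^ 2 * ∑ k ∈ T, ‖H (latticePt s k) 0‖ ≤ ε * (9 + 20 * c) := by
  classical
  set L := Real.log (1 / ε) with hLdef
  have hεL : ε = Real.exp (-L) := by
    rw [hLdef, one_div, Real.log_inv, neg_neg, Real.exp_log hε]
  have hπ := Real.pi_pos
  have hc := hH.nonneg
  have hs2 : s ^ 2 ≤ 38 * Real.pi / 1296 := by nlinarith [sq_nonneg s]
  have hexp : Real.exp (Real.pi / 8 * s ^ 2 / 2) ≤ 1.03 := by
    have : Real.pi / 8 * s ^ 2 / 2 ≤ 0.02 := by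
      have := Real.pi_lt_d2
      nlinarith [mul_le_mul_of_nonneg_left hs2 hπ.le]
    refine exp_le_of_le_sub ?_ ?_ <;> nlinarith
  have h8 : Real.pi / (Real.pi / 8) = 8 := by field_simp
  set r := √19 / 9 * s⁻¹ with hr
  -- The radius is reduced by the half-diagonal of a cell, as the lattice-sum bound demands.
  set ρ := r - s / √2 with hρdef
  have h19 : √(19 : ℝ) ≤ 4.36 := by rw [Real.sqrt_le_left (by norm_num)]; norm_num
  have h19' : (4 : ℝ) ≤ √19 := Real.le_sqrt_of_sq_le (by norm_num)
  have h2 : √(2 : ℝ) ≤ 1.415 := by rw [Real.sqrt_le_left (by norm_num)]; norm_num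
  have h2' : (1.4 : ℝ) ≤ √2 := Real.le_sqrt_of_sq_le (by norm_num)
  have hrs : r * s = √19 / 9 := by rw [hr]; field_simp
  have hdiv : s / √2 = s * √2 / 2 := by
    rw [div_eq_div_iff (by positivity) two_ne_zero, mul_assoc, Real.mul_self_sqrt zero_le_two]
  have hss : s / √2 * s = s ^ 2 * √2 / 2 := by rw [hdiv]; ring
  have hρ : 0 ≤ ρ := by
    have : 0 ≤ ρ * s := by
      rw [hρdef, sub_mul, hrs, hss]
      have := Real.pi_lt_d2
      nlinarith [sq_nonneg s]
    exact nonneg_of_mul_nonneg_left this hs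
  -- The radius √19/(9s) matches the mesh bound exactly: (π/8)(19/81) = 38π/1296. So the localizer
  -- is at most ε beyond distance r.
  have hr2 : L ≤ Real.pi / 8 * r ^ 2 := by
    have h1 : Real.pi / 8 * r ^ 2 = Real.pi / 8 * (19 / 81) / s ^ 2 := by
      rw [hr, mul_pow, div_pow, Real.sq_sqrt (by norm_num)]
      field_simp
      norm_num
    rw [h1, le_div_iff₀ (by positivity)]
    linarith
  -- Passing from r to ρ costs only the cross term, which is bounded because rs = √19/9.
  have hρ2 : L - 0.3 ≤ Real.pi / 8 * ρ ^ 2 := by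
    have h1 : ρ ^ 2 = r ^ 2 - √2 * (r * s) + (s / √2) ^ 2 := by
      have h3 : r * (s / √2) * 2 = √2 * (r * s) := by rw [hdiv]; ring
      rw [hρdef]
      linear_combination -h3
    have h4 : √2 * (r * s) ≤ 0.7 := by
      rw [hrs]
      nlinarith
    have h5 : Real.pi / 8 * (√2 * (r * s)) ≤ 0.3 := by
      have := Real.pi_lt_d2
      nlinarith
    have h6 : 0 ≤ Real.pi / 8 * (s / √2) ^ 2 := by positivity
    rw [h1]
    nlinarith
  have hexpρ : Real.exp (-(Real.pi / 8) * ρ ^ 2) ≤ 1.5 * ε := by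
    have h1 : Real.exp (-(Real.pi / 8) * ρ ^ 2) ≤ Real.exp (0.3 + -L) :=
      Real.exp_le_exp.2 (by linarith)
    refine h1.trans ?_
    rw [Real.exp_add, ← hεL]
    refine mul_le_mul_of_nonneg_right (exp_le_of_le_sub ?_ ?_) hε.le <;> norm_num
  have hin := sum_gaussian_lattice_le (by positivity : 0 < Real.pi / 8) hs le_rfl X
    (T.filter fun k => latticePt s k ∈ Ω) (Or.inl rfl)
  have hout := sum_gaussian_lattice_le (by positivity : 0 < Real.pi / 8) hs hρ X
    (T.filter fun k => latticePt s k ∉ Ω) (Or.inr fun k hk => by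
      have hk' := (Finset.mem_filter.1 hk).2
      have h1 : ENNReal.ofReal r ≤ edist X (latticePt s k) :=
        le_trans hX (infEDist_le_edist_of_mem ⟨latticePt_mem s k, hk'⟩)
      rw [edist_dist, ENNReal.ofReal_le_ofReal_iff dist_nonneg, dist_comm, dist_eq_norm] at h1
      rw [hρdef]
      linarith)
  rw [h8] at hin hout
  have hin' : s ^ 2 * ∑ k ∈ T.filter (fun k => latticePt s k ∈ Ω), ‖H (latticePt s k) 0‖ ≤
      ε * 9 := by
    have h1 : ∑ k ∈ T.filter (fun k => latticePt s k ∈ Ω), ‖H (latticePt s k) 0‖ ≤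
        ε * ∑ k ∈ T.filter (fun k => latticePt s k ∈ Ω),
          Real.exp (-(Real.pi / 8) * ‖latticePt s k - X‖ ^ 2) := by
      rw [Finset.mul_sum]
      exact Finset.sum_le_sum fun k hk => hΩ _ (Finset.mem_filter.1 hk).2
    have h2 := mul_le_mul_of_nonneg_left h1 (sq_nonneg s)
    have h3 := mul_le_mul_of_nonneg_left hin hε.le
    have h4 : Real.exp (Real.pi / 8 * s ^ 2 / 2) *
        (8 * Real.exp (-(Real.pi / 8) * 0 ^ 2)) ≤ 9 := by
      rw [zero_pow two_ne_zero, mul_zero, Real.exp_zero]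
      linarith
    have h5 := mul_le_mul_of_nonneg_left h4 hε.le
    linarith
  have hout' : s ^ 2 * ∑ k ∈ T.filter (fun k => latticePt s k ∉ Ω), ‖H (latticePt s k) 0‖ ≤
      c * (20 * ε) := by
    have h1 : ∑ k ∈ T.filter (fun k => latticePt s k ∉ Ω), ‖H (latticePt s k) 0‖ ≤
        c * ∑ k ∈ T.filter (fun k => latticePt s k ∉ Ω),
          Real.exp (-(Real.pi / 8) * ‖latticePt s k - X‖ ^ 2) := by
      rw [Finset.mul_sum]
      exact Finset.sum_le_sum fun k _ => by simpa using hH.bound (latticePt s k) 0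
    have h2 := mul_le_mul_of_nonneg_left h1 (sq_nonneg s)
    have h3 := mul_le_mul_of_nonneg_left hout hc
    have h4 : Real.exp (Real.pi / 8 * s ^ 2 / 2) *
        (8 * Real.exp (-(Real.pi / 8) * ρ ^ 2)) ≤ 20 * ε := by
      calc _ ≤ 1.03 * (8 * (1.5 * ε)) := by gcongr
        _ ≤ 20 * ε := by linarith
    have h5 := mul_le_mul_of_nonneg_left h4 hc
    linarith
  rw [← Finset.sum_filter_add_sum_filter_not T fun k => latticePt s k ∈ Ω, mul_add]
  linarith

theorem sum_gaussian_mesh_le {s : ℝ} (hs : 0 < s) (hs2 : s ^ 2 ≤ 38 * Real.pi / 1296) (x : ℝ)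
    (T : Finset ℤ) : s * ∑ k ∈ T, Real.exp (-(Real.pi / 8) * (s * k - x) ^ 2) ≤ 3 := by
  have hπ := Real.pi_pos
  have h := sq_sum_gaussian_int_le (by positivity : 0 < Real.pi / 8) hs x T
  have h8 : Real.pi / (Real.pi / 8) = 8 := by field_simp
  have hexp : Real.exp (Real.pi / 8 * s ^ 2 / 2) ≤ 1.03 := by
    have : Real.pi / 8 * s ^ 2 / 2 ≤ 0.02 := by
      have := Real.pi_lt_d2
      nlinarith [mul_le_mul_of_nonneg_left hs2 hπ.le]
    refine exp_le_of_le_sub ?_ ?_ <;> nlinarith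
  rw [h8] at h
  exact le_of_sq_le_sq (by linarith) (by norm_num)

/-- The Fourier transform of the localized function: interpolation between decay at high
frequencies and smallness at low frequencies. -/
theorem norm_fourier_le_sqrt {H : Plane → Plane → ℂ} {X : Plane} {c ε s : ℝ}
    (hH : GaussianExt H X c (Real.pi / 8) (17 * Real.pi / 8)) {Ω : Set Plane}
    (hε : 0 < ε) (hL : 1 < Real.log (1 / ε)) (hs : 0 < s)
    (hsL : s ^ 2 * Real.log (1 / ε) ≤ 38 * Real.pi / 1296)
    (hX : X ∈ interiorRegion s Ω)
    (hΩ : ∀ ω ∈ Ω, ‖H ω 0‖ ≤ ε * Real.exp (-(Real.pi / 8) * ‖ω - X‖ ^ 2)) (ξ : Plane) :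
    ‖𝓕 (fun x => H x 0) ξ‖ ≤
      2 * (1 + 5.2 * √c) ^ 2 * √ε * Real.exp (-(4 * Real.pi / 17) * ‖ξ‖ ^ 2) := by
  have hπ := Real.pi_pos
  have hc := hH.nonneg
  have hs2 : s ^ 2 ≤ 38 * Real.pi / 1296 := by nlinarith [sq_nonneg s]
  set L := Real.log (1 / ε) with hLdef
  set q := √c with hq
  have hq0 : 0 ≤ q := Real.sqrt_nonneg c
  have hcq : c = q ^ 2 := (Real.sq_sqrt hc).symm
  have h8 : Real.pi / (Real.pi / 8) = 8 := by field_simp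
  set e := Real.exp (-(4 * Real.pi / 17) * ‖ξ‖ ^ 2) with he
  have he0 : 0 < e := Real.exp_pos _
  have hdecay : ‖𝓕 (fun x => H x 0) ξ‖ ≤ 8 * c * e ^ 2 := by
    have h1 := hH.norm_fourier_le (by positivity) (by positivity) ξ
    rw [h8] at h1
    refine h1.trans (le_of_eq ?_)
    have h2 : e ^ 2 = Real.exp (-(Real.pi ^ 2 / (17 * Real.pi / 8)) * ‖ξ‖ ^ 2) := by
      rw [he, ← Real.exp_nat_mul]
      congr 1
      push_cast
      field_simp
      ring
    rw [h2]
    simp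
    ring
  -- The threshold is where e² = exp(-8π/17 |ξ|²) equals ε.
  by_cases hlow : Real.pi * ‖ξ‖ ^ 2 ≤ 17 / 8 * L
  · have hsmall : ‖𝓕 (fun x => H x 0) ξ‖ ≤ ε * (9 + 70 * c) := by
      have hcomp : ∀ i : Fin 2, Real.pi * ξ i ^ 2 ≤ 17 / 8 * L := fun i => by
        refine le_trans (mul_le_mul_of_nonneg_left ?_ hπ.le) hlow
        rw [norm_sq_plane]
        fin_cases i
        · exact le_add_of_nonneg_right (sq_nonneg _)
        · exact le_add_of_nonneg_left (sq_nonneg _)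
      have h1 := hH.norm_fourier_le_of_samples (by positivity) (by positivity) hs ξ (ε := ε)
        (fun i m hm => aliasing_decay hε hL hs hsL (hcomp i) hm)
        (sum_samples_le hH hε hL hs hsL hX hΩ) (sum_gaussian_mesh_le hs hs2 (X 0))
      rw [h8] at h1
      refine h1.trans ?_
      have h3 : √(8 : ℝ) ^ 2 = 8 := Real.sq_sqrt (by norm_num)
      have h4 : √(8 : ℝ) ≤ 2.83 := by rw [Real.sqrt_le_left (by norm_num)]; norm_num
      -- Aliasing contributes 50c, which joins 9 + 20c from the samples.
      have h5 : √(8 : ℝ) * 3 * (√8 + 3) ≤ 50 := by nlinarith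
      have h6 := mul_le_mul_of_nonneg_left h5 (mul_nonneg hc hε.le)
      nlinarith
    -- Geometric mean: the square of the norm is at most the low-frequency bound times the decay
    -- bound.
    refine le_of_sq_le_sq ?_ (by positivity)
    have h1 : ‖𝓕 (fun x => H x 0) ξ‖ ^ 2 ≤ ε * (9 + 70 * c) * (8 * c * e ^ 2) := by
      rw [sq]
      exact mul_le_mul hsmall hdecay (norm_nonneg _) (by positivity)
    refine h1.trans ?_
    rw [mul_pow, mul_pow, Real.sq_sqrt hε.le, hcq]
    have h2 : (9 + 70 * q ^ 2) * (8 * q ^ 2) ≤ (2 * (1 + 5.2 * q) ^ 2) ^ 2 := by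
      have h3 : 0 ≤ q ^ 3 := by positivity
      have h4 : 0 ≤ q ^ 4 := by positivity
      nlinarith [sq_nonneg q]
    have h3 := mul_le_mul_of_nonneg_right h2 (by positivity : 0 ≤ ε * e ^ 2)
    linarith
  · push Not at hlow
    have hel : e ≤ √ε := by
      refine Real.le_sqrt_of_sq_le ?_
      rw [he, ← Real.exp_nat_mul]
      have hεL : ε = Real.exp (-L) := by
        rw [hLdef, one_div, Real.log_inv, neg_neg, Real.exp_log hε]
      rw [hεL]
      refine Real.exp_le_exp.2 ?_
      push_cast
      linarith
    refine hdecay.trans ?_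
    have h1 : 8 * c ≤ 2 * (1 + 5.2 * q) ^ 2 := by rw [hcq]; nlinarith
    calc 8 * c * e ^ 2 = 8 * c * e * e := by ring
      _ ≤ 2 * (1 + 5.2 * q) ^ 2 * √ε * e := by gcongr

/-- Stability of analytic continuation from lattice samples. -/
theorem norm_le_of_lattice_samples {D : (Fin 2 → ℂ) → ℂ} (hD : Differentiable ℂ D) {c ε s : ℝ}
    (hc : ∀ x y, ‖D (complexPt x y)‖ ≤ c * Real.exp (2 * Real.pi * ‖y‖ ^ 2))
    (hε : 0 < ε) (hε' : ε < Real.exp (-1)) (hs : 0 < s)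
    (hsε : s ≤ √(38 * Real.pi) / 36 * (Real.log (1 / ε)) ^ (-(1 / 2) : ℝ))
    {Ω : Set Plane} {X : Plane} (hX : X ∈ interiorRegion s Ω)
    (hΩ : ∀ ω ∈ Ω, ‖D (toC ω)‖ ≤ ε) (b : Plane) :
    ‖D (complexPt X b)‖ ≤
      8.5 * (1 + 5.2 * √c) ^ 2 * √ε * Real.exp (33 * Real.pi / 8 * ‖b‖ ^ 2) := by
  have hπ := Real.pi_pos
  obtain ⟨hL, hsL⟩ := mesh_sq_mul_log_le hε hε' hs hsε
  have hH := gaussianExt_localized hD hc X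
  have hF := norm_fourier_le_sqrt hH hε hL hs hsL hX (fun ω hω => by
    rw [norm_localized, complexPt_zero_right, norm_zero]
    simp only [ne_eq, OfNat.ofNat_ne_zero, not_false_eq_true, zero_pow, mul_zero, add_zero]
    exact mul_le_mul_of_nonneg_right (hΩ ω hω) (Real.exp_pos _).le)
  have h1 := hH.norm_le_of_fourier_le (by positivity) (by positivity) (by positivity) hF X b
  -- At real part `X` the localizer has modulus exp(π/8 |b|²). Dividing it out leaves 17π/4 - π/8 =
  -- 33π/8, and the constant is 2 · 17/4 = 8.5.
  rw [norm_localized, sub_self, norm_zero] at h1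
  have h2 : Real.pi / (4 * Real.pi / 17) = 17 / 4 := by field_simp
  have h3 : Real.pi ^ 2 / (4 * Real.pi / 17) * ‖b‖ ^ 2 =
      33 * Real.pi / 8 * ‖b‖ ^ 2 + (-(Real.pi / 8) * 0 ^ 2 + Real.pi / 8 * ‖b‖ ^ 2) := by
    field_simp
    ring
  rw [h2, h3, Real.exp_add (33 * Real.pi / 8 * ‖b‖ ^ 2), ← mul_assoc] at h1
  refine (le_of_mul_le_mul_right h1 (Real.exp_pos _)).trans (le_of_eq ?_)
  ring

/-! ### The entire extension of the spectrogram and its growth. -/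

/-- The (unnormalized) Bargmann transform `ζ ↦ ∫ f(t) exp(-π t² + 2π t ζ) dt`. -/
def bargmann (f : ℝ → ℂ) (ζ : ℂ) : ℂ :=
  ∫ t : ℝ, f t * Complex.exp (-Real.pi * (t : ℂ) ^ 2 + 2 * Real.pi * t * ζ)

theorem integrable_norm_sq {f : ℝ → ℂ} (hf : MemLp f 2 volume) :
    Integrable fun t => ‖f t‖ ^ 2 := hf.norm.integrable_sq

theorem differentiable_bargmann {f : ℝ → ℂ} (hf : MemLp f 2 volume) :
    Differentiable ℂ (bargmann f) := by
  have hπ := Real.pi_pos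
  refine differentiable_integral_of_dominated (fun ζ => ?_) (fun t => by fun_prop) fun R => ?_
  · exact hf.1.mul (Continuous.aestronglyMeasurable (by fun_prop))
  · have hg : Integrable fun t : ℝ => Real.exp (-Real.pi * t ^ 2) :=
      integrable_exp_neg_mul_sq hπ
    refine ⟨fun t => ‖f t‖ ^ 2 + Real.exp (4 * Real.pi * R ^ 2) * Real.exp (-Real.pi * t ^ 2),
      (integrable_norm_sq hf).add (hg.const_mul _), fun t ζ hζ => ?_⟩
    have hre : |ζ.re| ≤ R := (Complex.abs_re_le_norm ζ).trans hζ
    have hn : ‖Complex.exp (-Real.pi * (t : ℂ) ^ 2 + 2 * Real.pi * t * ζ)‖ =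
        Real.exp (-Real.pi * t ^ 2 + 2 * Real.pi * t * ζ.re) := by
      rw [Complex.norm_exp]
      congr 1
      rw [show (-Real.pi * (t : ℂ) ^ 2 + 2 * Real.pi * t * ζ) =
        ((-Real.pi * t ^ 2 : ℝ) : ℂ) + ((2 * Real.pi * t : ℝ) : ℂ) * ζ by push_cast; ring,
        Complex.add_re, Complex.ofReal_re, Complex.re_ofReal_mul]
    rw [norm_mul, hn]
    set E := Real.exp (-Real.pi * t ^ 2 + 2 * Real.pi * t * ζ.re) with hE
    -- Completing the square in t - 2 Re ζ; the domination then follows from |f|E ≤ |f|² + E².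
    have h1 : E ^ 2 ≤ Real.exp (4 * Real.pi * R ^ 2) * Real.exp (-Real.pi * t ^ 2) := by
      rw [hE, ← Real.exp_nat_mul, ← Real.exp_add]
      refine Real.exp_le_exp.2 ?_
      push_cast
      have h2 : ζ.re ^ 2 ≤ R ^ 2 := sq_le_sq.2 (hre.trans (le_abs_self R))
      have h3 := mul_le_mul_of_nonneg_left h2 hπ.le
      have h4 := mul_nonneg hπ.le (sq_nonneg (t - 2 * ζ.re))
      nlinarith
    nlinarith [sq_nonneg (‖f t‖ - E), sq_nonneg (‖f t‖ + E)]

theorem gabor_eq_bargmann (f : ℝ → ℂ) (p : Plane) :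
    gabor f p = (((2 : ℝ) ^ (1 / 4 : ℝ) : ℝ) : ℂ) * (Complex.exp (-Real.pi * (p 0 : ℂ) ^ 2) *
      bargmann f (p 0 - Complex.I * p 1)) := by
  rw [gabor, bargmann, ← integral_const_mul (Complex.exp (-Real.pi * (p 0 : ℂ) ^ 2))]
  congr 1
  refine integral_congr_ae (Eventually.of_forall fun t => ?_)
  beta_reduce
  rw [Complex.ofReal_exp, mul_left_comm, mul_assoc, ← Complex.exp_add, ← Complex.exp_add]
  congr 2
  push_cast
  ring

theorem conj_bargmann (f : ℝ → ℂ) (ζ : ℂ) :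
    conj (bargmann f ζ) = bargmann (fun t => conj (f t)) (conj ζ) := by
  rw [bargmann, bargmann, ← integral_conj]
  congr 1
  ext t
  rw [map_mul, ← Complex.exp_conj]
  simp only [map_add, map_mul, map_neg, map_pow, Complex.conj_ofReal, Complex.conj_ofNat]

/-- The entire extension of the spectrogram. -/
def spectrogramExt (f : ℝ → ℂ) (z : Fin 2 → ℂ) : ℂ :=
  ((((2 : ℝ) ^ (1 / 4 : ℝ) : ℝ) : ℂ)) ^ 2 * Complex.exp (-2 * Real.pi * z 0 ^ 2) *
    bargmann f (z 0 - Complex.I * z 1) *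
    bargmann (fun t => conj (f t)) (z 0 + Complex.I * z 1)

theorem differentiable_spectrogramExt {f : ℝ → ℂ} (hf : MemLp f 2 volume) :
    Differentiable ℂ (spectrogramExt f) := by
  have h1 := differentiable_bargmann hf
  have h2 := differentiable_bargmann (f := fun t => conj (f t)) hf.star
  unfold spectrogramExt
  refine Differentiable.mul (Differentiable.mul (by fun_prop) (h1.comp (by fun_prop)))
    (h2.comp (by fun_prop))

/-- The evaluation operator maps the extended spectrogram to `𝒢f(p+u) · conj (𝒢f(p))`. -/
theorem evalOp_spectrogramExt (f : ℝ → ℂ) (p u : Plane) :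
    evalOp (spectrogramExt f) p u = tensorShift u (gabor f) p := by
  rw [evalOp, spectrogramExt, tensorShift, gabor_eq_bargmann, gabor_eq_bargmann]
  simp only [map_mul, conj_bargmann, ← Complex.exp_conj, map_neg, map_pow, Complex.conj_ofReal]
  -- `evalL` decouples the two Bargmann factors: z₀ - i z₁ sees only p + u, and z₀ + i z₁ only p.
  have e1 : evalL p u 0 - Complex.I * evalL p u 1 =
      ((p + u) 0 : ℝ) - Complex.I * ((p + u) 1 : ℝ) := by
    simp only [evalL, Matrix.cons_val_zero, Matrix.cons_val_one, PiLp.add_apply]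
    push_cast
    linear_combination (-(1 / 2 : ℂ) * u 0) * Complex.I_sq
  have e2 : evalL p u 0 + Complex.I * evalL p u 1 =
      conj ((p 0 : ℂ) - Complex.I * p 1) := by
    simp only [evalL, Matrix.cons_val_zero, Matrix.cons_val_one, map_sub, map_mul,
      Complex.conj_ofReal, Complex.conj_I]
    linear_combination ((1 / 2 : ℂ) * u 0) * Complex.I_sq
  have e3 : Complex.exp (-2 * Real.pi * evalL p u 0 ^ 2) * Complex.exp (evalQ p u) =
      Complex.exp (-Real.pi * ((p + u) 0 : ℝ) ^ 2) *
        Complex.exp (-Real.pi * (p 0 : ℂ) ^ 2) := by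
    rw [← Complex.exp_add, ← Complex.exp_add]
    congr 1
    simp only [evalL, evalQ, Matrix.cons_val_zero, norm_sq_plane, PiLp.add_apply]
    push_cast
    linear_combination (-(1 / 2 : ℂ) * Real.pi * u 1 ^ 2) * Complex.I_sq
  rw [e1, e2]
  linear_combination ((((2 : ℝ) ^ (1 / 4 : ℝ) : ℝ) : ℂ) ^ 2 *
    bargmann f (((p + u) 0 : ℝ) - Complex.I * ((p + u) 1 : ℝ)) *
    bargmann (fun t => conj (f t)) (conj ((p 0 : ℂ) - Complex.I * p 1))) * e3

/-- The real part is the midpoint of p and p + u, and the imaginary part is u/2 turned by a right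
angle. Hence the condition on p + u/2 in the theorem. -/
theorem evalL_eq_complexPt (p u : Plane) :
    evalL p u = complexPt (p + (1 / 2 : ℝ) • u) !₂[-(u 1 / 2), u 0 / 2] := by
  ext i
  fin_cases i
  · simp [evalL, complexPt]; ring
  · simp [evalL, complexPt]; ring

theorem evalL_zero (p : Plane) : evalL p 0 = toC p := by
  ext i
  fin_cases i <;> simp [evalL, toC]

theorem spectrogramExt_toC (f : ℝ → ℂ) (p : Plane) :
    spectrogramExt f (toC p) = (spectrogram f p : ℂ) := by
  have h := evalOp_spectrogramExt f p 0
  rw [evalOp, evalL_zero, tensorShift, add_zero, Complex.mul_conj] at h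
  have hQ : evalQ p 0 = 0 := by simp [evalQ]
  rw [hQ, Complex.exp_zero, mul_one] at h
  rw [h, spectrogram, Complex.normSq_eq_norm_sq]

theorem continuous_spectrogram {f : ℝ → ℂ} (hf : MemLp f 2 volume) :
    Continuous (spectrogram f) := by
  have h : Continuous fun p => (spectrogramExt f (toC p)).re :=
    Complex.continuous_re.comp ((differentiable_spectrogramExt hf).continuous.comp
      (by unfold toC; fun_prop))
  simpa only [spectrogramExt_toC, Complex.ofReal_re] using h

/-- Guarantees that the essential supremum is finite, so that its `toReal` is not the default value
0. -/
theorem exists_norm_gabor_le {f : ℝ → ℂ} (hf : MemLp f 2 volume) :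
    ∃ C, ∀ p, ‖gabor f p‖ ≤ C := by
  have hg : Integrable fun t : ℝ => Real.exp (-Real.pi * t ^ 2) :=
    integrable_exp_neg_mul_sq Real.pi_pos
  refine ⟨(2 : ℝ) ^ (1 / 4 : ℝ) *
    ((∫ t, ‖f t‖ ^ 2) + ∫ t : ℝ, Real.exp (-Real.pi * t ^ 2)), fun p => ?_⟩
  rw [gabor, norm_mul, Complex.norm_real, Real.norm_eq_abs, abs_of_nonneg (by positivity),
    ← integral_sub_right_eq_self (fun t : ℝ => Real.exp (-Real.pi * t ^ 2)) (p 0),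
    ← integral_add (integrable_norm_sq hf) (hg.comp_sub_right (p 0))]
  refine mul_le_mul_of_nonneg_left (norm_integral_le_of_norm_le
    ((integrable_norm_sq hf).add (hg.comp_sub_right (p 0)))
    (Eventually.of_forall fun t => ?_)) (by positivity)
  have h1 : ‖Complex.exp (-2 * Real.pi * Complex.I * (p 1 : ℂ) * (t : ℂ))‖ = 1 := by
    rw [show (-2 * Real.pi * Complex.I * (p 1 : ℂ) * (t : ℂ)) =
      ((-2 * Real.pi * p 1 * t : ℝ) : ℂ) * Complex.I by push_cast; ring,
      Complex.norm_exp_ofReal_mul_I]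
  have h0 := Real.exp_pos (-Real.pi * (t - p 0) ^ 2)
  have h2 : Real.exp (-Real.pi * (t - p 0) ^ 2) ≤ 1 := by
    rw [Real.exp_le_one_iff]
    nlinarith [mul_nonneg Real.pi_pos.le (sq_nonneg (t - p 0))]
  rw [norm_mul, norm_mul, h1, mul_one, Complex.norm_real, Real.norm_eq_abs, abs_of_pos h0]
  nlinarith [sq_nonneg (‖f t‖ - Real.exp (-Real.pi * (t - p 0) ^ 2)), norm_nonneg (f t),
    sq_nonneg (‖f t‖ + Real.exp (-Real.pi * (t - p 0) ^ 2))]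

/-- The bound holds almost everywhere, hence on a dense set, and this set is closed by continuity.
-/
theorem spectrogram_le_sup {f : ℝ → ℂ} (hf : MemLp f 2 volume) (p : Plane) :
    spectrogram f p ≤ spectrogramSup f := by
  obtain ⟨C, hC⟩ := exists_norm_gabor_le hf
  have hfin : eLpNorm (spectrogram f) ∞ (volume : Measure Plane) ≠ ∞ := by
    rw [eLpNorm_exponent_top]
    refine (eLpNormEssSup_lt_top_of_ae_bound (C := C ^ 2) (Eventually.of_forall fun q => ?_)).ne
    rw [spectrogram, Real.norm_eq_abs, abs_of_nonneg (by positivity)]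
    exact pow_le_pow_left₀ (norm_nonneg _) (hC q) 2
  have hae : ∀ᵐ q : Plane, spectrogram f q ≤ spectrogramSup f := by
    filter_upwards [ae_le_eLpNormEssSup (f := spectrogram f) (μ := (volume : Measure Plane))]
      with q hq
    rw [← eLpNorm_exponent_top] at hq
    have h1 := ENNReal.toReal_mono hfin hq
    rw [toReal_enorm, Real.norm_eq_abs] at h1
    exact (le_abs_self _).trans h1
  have hcl : IsClosed {q | spectrogram f q ≤ spectrogramSup f} :=
    isClosed_le (continuous_spectrogram hf) continuous_const
  have hd : Dense {q | spectrogram f q ≤ spectrogramSup f} := Measure.dense_of_ae hae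
  have : p ∈ closure {q | spectrogram f q ≤ spectrogramSup f} := hd p
  rwa [hcl.closure_eq] at this

theorem norm_exp_evalQ (p u : Plane) :
    ‖Complex.exp (evalQ p u)‖ = Real.exp (-(Real.pi / 2) * ‖u‖ ^ 2) := by
  rw [Complex.norm_exp]
  congr 1
  rw [evalQ, show (-(Real.pi / 2 : ℂ) * ((‖u‖ ^ 2 : ℝ) : ℂ) -
    Real.pi * Complex.I * (((2 * p 0 + u 0) * u 1 : ℝ) : ℂ)) =
    ((-(Real.pi / 2) * ‖u‖ ^ 2 : ℝ) : ℂ) +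
      ((-Real.pi * ((2 * p 0 + u 0) * u 1) : ℝ) : ℂ) * Complex.I by push_cast; ring,
    Complex.add_re, Complex.ofReal_re, Complex.re_ofReal_mul, Complex.I_re, mul_zero, add_zero]

/-- Every complex point is `evalL p u` for suitable p, u with |u| = 2|y|. There the extension is a
product of two Gabor values, up to the factor exp(π/2 |u|²) = exp(2π|y|²). -/
theorem norm_spectrogramExt_le {f : ℝ → ℂ} (hf : MemLp f 2 volume) (x y : Plane) :
    ‖spectrogramExt f (complexPt x y)‖ ≤
      spectrogramSup f * Real.exp (2 * Real.pi * ‖y‖ ^ 2) := by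
  set u : Plane := !₂[2 * y 1, -(2 * y 0)] with hu
  set p : Plane := x - (1 / 2 : ℝ) • u with hp
  have hL : evalL p u = complexPt x y := by
    rw [evalL_eq_complexPt, hp, sub_add_cancel]
    congr 1
    ext i
    fin_cases i <;> simp [hu, neg_div]
  have hun : ‖u‖ ^ 2 = 4 * ‖y‖ ^ 2 := by
    rw [hu, norm_sq_vec, norm_sq_plane]; ring
  have h := congrArg norm (evalOp_spectrogramExt f p u)
  rw [evalOp, norm_mul, hL, norm_exp_evalQ, hun, tensorShift, norm_mul, RCLike.norm_conj] at h
  have h1 : ‖gabor f (p + u)‖ * ‖gabor f p‖ ≤ spectrogramSup f := by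
    have e1 := spectrogram_le_sup hf (p + u)
    have e2 := spectrogram_le_sup hf p
    unfold spectrogram at e1 e2
    nlinarith [sq_nonneg (‖gabor f (p + u)‖ - ‖gabor f p‖)]
  rw [← h] at h1
  have h2 := mul_le_mul_of_nonneg_right h1 (Real.exp_pos (2 * Real.pi * ‖y‖ ^ 2)).le
  rw [mul_assoc, ← Real.exp_add] at h2
  have h3 : -(Real.pi / 2) * (4 * ‖y‖ ^ 2) + 2 * Real.pi * ‖y‖ ^ 2 = 0 := by ring
  rwa [h3, Real.exp_zero, mul_one] at h2

/-! ### Growth of the Ansatz function. -/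

/-- Separates `l` from `m` in the modulus, so that the double sum in `ansatz` is dominated by a
product of two lattice sums. -/
theorem norm_phi (l m x y : Plane) :
    ‖phi l m (complexPt x y)‖ = Real.exp (2 * Real.pi * ‖y‖ ^ 2) *
      (Real.exp (-(Real.pi / 2) * ‖l - (x + !₂[y 1, -y 0])‖ ^ 2) *
        Real.exp (-(Real.pi / 2) * ‖m - (x - !₂[y 1, -y 0])‖ ^ 2)) := by
  rw [phi, phiConst, ← Complex.exp_add, ← Complex.exp_add, Complex.norm_exp, ← Real.exp_add,
    ← Real.exp_add]
  congr 1
  have hl : ‖l - (x + !₂[y 1, -y 0])‖ ^ 2 = (l 0 - (x 0 + y 1)) ^ 2 + (l 1 - (x 1 - y 0)) ^ 2 := by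
    rw [norm_sq_plane]; simp; ring
  have hm : ‖m - (x - !₂[y 1, -y 0])‖ ^ 2 = (m 0 - (x 0 - y 1)) ^ 2 + (m 1 - (x 1 + y 0)) ^ 2 := by
    rw [norm_sq_plane]; simp
  have hlm : ‖l - m‖ ^ 2 = (l 0 - m 0) ^ 2 + (l 1 - m 1) ^ 2 := by
    rw [norm_sq_plane]; simp
  rw [hl, hm, hlm, norm_sq_plane y, ← Complex.ofReal_re
    (2 * Real.pi * (y 0 ^ 2 + y 1 ^ 2) +
      (-(Real.pi / 2) * ((l 0 - (x 0 + y 1)) ^ 2 + (l 1 - (x 1 - y 0)) ^ 2) +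
        -(Real.pi / 2) * ((m 0 - (x 0 - y 1)) ^ 2 + (m 1 - (x 1 + y 0)) ^ 2)))]
  have him : ∀ (a : ℂ) (r t : ℝ), a = (r : ℂ) + (t : ℂ) * Complex.I → a.re = ((r : ℝ) : ℂ).re := by
    intro a r t h
    rw [h, Complex.add_re, Complex.re_ofReal_mul, Complex.I_re, mul_zero, add_zero]
  refine him _ _ (Real.pi * (l 0 * l 1 - m 0 * m 1) +
    Real.pi * (x 0 * (l 1 - m 1) - x 1 * (l 0 - m 0)) -
    2 * Real.pi * ((x 0 - (l 0 + m 0) / 2) * y 0 + (x 1 - (l 1 + m 1) / 2) * y 1)) ?_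
  simp only [complexPt, Fin.sum_univ_two]
  push_cast
  linear_combination (Real.pi * (y 0 * (l 1 - m 1) - y 1 * (l 0 - m 0)) -
    Real.pi * (y 0 ^ 2 + y 1 ^ 2) : ℂ) * Complex.I_sq

theorem differentiable_ansatz {Γ : Finset Plane} (A : Matrix Γ Γ ℂ) :
    Differentiable ℂ (ansatz A) := by
  unfold ansatz phi
  simp only [Fin.sum_univ_two]
  fun_prop

theorem norm_le_maxDiag {Γ : Finset Plane} {A : Matrix Γ Γ ℂ} (hA : A.PosSemidef) (l m : Γ) :
    ‖A l m‖ ≤ maxDiag A := by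
  have hb : BddAbove (Set.range fun l : Γ => (A l l).re) := Set.finite_range _ |>.bddAbove
  have hd : ∀ l : Γ, 0 ≤ (A l l).re ∧ (A l l).im = 0 := fun l => by
    have := Complex.le_def.1 (hA.diag_nonneg (i := l))
    exact ⟨by simpa using this.1, by simpa using this.2.symm⟩
  have hle : ∀ l : Γ, (A l l).re ≤ maxDiag A := fun l => le_ciSup hb l
  -- Nonnegative 2×2 minors give |A l m|² ≤ A l l · A m m; the case l = m is included.
  have hdet := (hA.submatrix ![l, m]).det_nonneg
  rw [Matrix.det_fin_two] at hdet
  simp only [Matrix.submatrix_apply, Matrix.cons_val_zero, Matrix.cons_val_one] at hdet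
  have hml : A m l = conj (A l m) := (hA.isHermitian.apply m l).symm
  rw [hml, Complex.mul_conj] at hdet
  have h1 := (Complex.le_def.1 hdet).1
  rw [Complex.zero_re, Complex.sub_re, Complex.mul_re, (hd l).2, zero_mul, sub_zero,
    Complex.ofReal_re, Complex.normSq_eq_norm_sq] at h1
  have hM : 0 ≤ maxDiag A := (hd l).1.trans (hle l)
  refine le_of_sq_le_sq ?_ hM
  have h2 := mul_le_mul (hle l) (hle m) (hd m).1 hM
  nlinarith

theorem maxDiag_nonneg {Γ : Finset Plane} {A : Matrix Γ Γ ℂ} (hA : A.PosSemidef) :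
    0 ≤ maxDiag A :=
  Real.iSup_nonneg fun l => by
    simpa using (Complex.le_def.1 (hA.diag_nonneg (i := l))).1

/-- Cell comparison with a = π/2 and h² = 1/2 bounds the sum by 4 exp(π/8). -/
theorem sum_gaussian_mesh_points_le {Γ : Finset Plane}
    (hΓ : (Γ : Set Plane) ⊆ squareLattice meshA) (P : Plane) :
    ∑ l : Γ, Real.exp (-(Real.pi / 2) * ‖(l : Plane) - P‖ ^ 2) ≤ 8 := by
  have hmesh : 0 < meshA := by unfold meshA; positivity
  have hmesh2 : meshA ^ 2 = 1 / 2 := by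
    rw [meshA, div_pow, Real.sq_sqrt zero_le_two, one_pow]
  choose κ hκ using fun (l : Γ) (i : Fin 2) => hΓ l.2 i
  have hpt : ∀ l : Γ, latticePt meshA (κ l 0, κ l 1) = l := fun l => by
    ext i
    fin_cases i
    · exact (hκ l 0).symm
    · exact (hκ l 1).symm
  have hinj : Function.Injective fun l : Γ => (κ l 0, κ l 1) := fun l m h => by
    have h1 := hpt l
    have h2 := hpt m
    simp only at h
    rw [h] at h1
    exact Subtype.ext (h1.symm.trans h2)
  have h := sum_gaussian_lattice_le (by positivity : 0 < Real.pi / 2) hmesh le_rfl P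
    (Finset.univ.map ⟨_, hinj⟩) (Or.inl rfl)
  rw [Finset.sum_map] at h
  simp only [Function.Embedding.coeFn_mk, hpt, hmesh2] at h
  rw [zero_pow two_ne_zero, mul_zero, Real.exp_zero, mul_one,
    show Real.pi / (Real.pi / 2) = 2 by field_simp] at h
  have hexp : Real.exp (Real.pi / 2 * (1 / 2) / 2) ≤ 2 := by
    have := Real.pi_lt_d2
    refine exp_le_of_le_sub ?_ ?_ <;> linarith
  linarith

theorem norm_ansatz_le {Γ : Finset Plane} (hΓ : (Γ : Set Plane) ⊆ squareLattice meshA)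
    {A : Matrix Γ Γ ℂ} (hA : A.PosSemidef) (x y : Plane) :
    ‖ansatz A (complexPt x y)‖ ≤ 64 * maxDiag A * Real.exp (2 * Real.pi * ‖y‖ ^ 2) := by
  have hM := maxDiag_nonneg hA
  set P : Plane := x + !₂[y 1, -y 0]
  set P' : Plane := x - !₂[y 1, -y 0]
  have h1 := sum_gaussian_mesh_points_le hΓ P
  have h2 := sum_gaussian_mesh_points_le hΓ P'
  have h3 : (∑ l : Γ, Real.exp (-(Real.pi / 2) * ‖(l : Plane) - P‖ ^ 2)) *
      (∑ m : Γ, Real.exp (-(Real.pi / 2) * ‖(m : Plane) - P'‖ ^ 2)) ≤ 8 * 8 := by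
    gcongr
  calc ‖ansatz A (complexPt x y)‖
      ≤ ∑ l : Γ, ∑ m : Γ, maxDiag A * Real.exp (2 * Real.pi * ‖y‖ ^ 2) *
        (Real.exp (-(Real.pi / 2) * ‖(l : Plane) - P‖ ^ 2) *
          Real.exp (-(Real.pi / 2) * ‖(m : Plane) - P'‖ ^ 2)) := by
        unfold ansatz
        refine (norm_sum_le _ _).trans (Finset.sum_le_sum fun l _ =>
          (norm_sum_le _ _).trans (Finset.sum_le_sum fun m _ => ?_))
        rw [norm_mul, norm_phi, mul_assoc (maxDiag A)]
        exact mul_le_mul_of_nonneg_right (norm_le_maxDiag hA l m) (by positivity)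
    _ = maxDiag A * Real.exp (2 * Real.pi * ‖y‖ ^ 2) *
        ((∑ l : Γ, Real.exp (-(Real.pi / 2) * ‖(l : Plane) - P‖ ^ 2)) *
          ∑ m : Γ, Real.exp (-(Real.pi / 2) * ‖(m : Plane) - P'‖ ^ 2)) := by
        rw [Finset.sum_mul_sum, Finset.mul_sum]
        exact Finset.sum_congr rfl fun l _ => (Finset.mul_sum _ _ _).symm
    _ ≤ maxDiag A * Real.exp (2 * Real.pi * ‖y‖ ^ 2) * (8 * 8) :=
        mul_le_mul_of_nonneg_left h3 (by positivity)
    _ = 64 * maxDiag A * Real.exp (2 * Real.pi * ‖y‖ ^ 2) := by ring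

end GaborPhase

end

/-! ### The theorem. -/

theorem mainTheorem6 (f : ℝ → ℂ) (hf : MeasureTheory.MemLp f 2 MeasureTheory.volume)
    (ε : ℝ) (hε : 0 < ε) (hε' : ε < Real.exp (-1))
    (s : ℝ) (hs : 0 < s)
    (hsε : s ≤ √(38 * Real.pi) / 36 * (Real.log (1 / ε)) ^ (-(1 / 2) : ℝ))
    (Ω : Set GaborPhase.Plane) (hΩ : Ω ⊆ GaborPhase.squareLattice s)
    (Γ : Finset GaborPhase.Plane)
    (hΓ : (Γ : Set GaborPhase.Plane) ⊆ GaborPhase.squareLattice GaborPhase.meshA)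
    (p u : GaborPhase.Plane)
    (hpu : p + (1 / 2 : ℝ) • u ∈ GaborPhase.interiorRegion s Ω)
    (A : Matrix Γ Γ ℂ) (hA : A ∈ GaborPhase.admissible ε f Γ Ω) :
    ‖GaborPhase.evalOp (GaborPhase.ansatz A) p u -
        GaborPhase.tensorShift u (GaborPhase.gabor f) p‖ ≤
      8.6 * (1 + 5.2 * √(GaborPhase.c0 f A)) ^ 2 * √ε *
        Real.exp (17 * Real.pi / 32 * ‖u‖ ^ 2) := by
  open GaborPhase in
  have hc : ∀ x y, ‖ansatz A (complexPt x y) - spectrogramExt f (complexPt x y)‖ ≤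
      c0 f A * Real.exp (2 * Real.pi * ‖y‖ ^ 2) := by
    intro x y
    have h1 := norm_ansatz_le hΓ hA.1 x y
    have h2 := norm_spectrogramExt_le hf x y
    have h3 := mul_nonneg (maxDiag_nonneg hA.1) (Real.exp_pos (2 * Real.pi * ‖y‖ ^ 2)).le
    refine (norm_sub_le _ _).trans ?_
    rw [c0]
    linarith
  have hD : Differentiable ℂ fun z => GaborPhase.ansatz A z - GaborPhase.spectrogramExt f z :=
    (GaborPhase.differentiable_ansatz A).sub (GaborPhase.differentiable_spectrogramExt hf)
  have key := GaborPhase.norm_le_of_lattice_samples hD hc hε hε' hs hsε hpu (fun ω hω => by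
    rw [GaborPhase.spectrogramExt_toC]
    exact hA.2 ω hω) !₂[-(u 1 / 2), u 0 / 2]
  rw [← GaborPhase.evalL_eq_complexPt, GaborPhase.norm_sq_vec] at key
  have hu := GaborPhase.norm_sq_plane u
  have he : GaborPhase.evalOp (GaborPhase.ansatz A) p u -
      GaborPhase.tensorShift u (GaborPhase.gabor f) p =
      (GaborPhase.ansatz A (GaborPhase.evalL p u) -
        GaborPhase.spectrogramExt f (GaborPhase.evalL p u)) *
        Complex.exp (GaborPhase.evalQ p u) := by
    rw [← GaborPhase.evalOp_spectrogramExt, GaborPhase.evalOp, GaborPhase.evalOp, sub_mul]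
  rw [he, norm_mul, GaborPhase.norm_exp_evalQ]
  refine (mul_le_mul_of_nonneg_right key (Real.exp_pos _).le).trans ?_
  rw [mul_assoc _ (Real.exp _), ← Real.exp_add]
  -- With |b|² = |u|²/4 the exponent is 33π/32, and |exp Q| removes 16π/32.
  have hexp : 33 * Real.pi / 8 * ((-(u 1 / 2)) ^ 2 + (u 0 / 2) ^ 2) +
      -(Real.pi / 2) * ‖u‖ ^ 2 = 17 * Real.pi / 32 * ‖u‖ ^ 2 := by
    rw [hu]; ring
  rw [hexp]
  gcongr
  norm_num
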